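/- **Conventions.** A partial linear space is a non-empty set $P$ of points with a family of proper subsets, called lines, such that every line has at least two points, every point lies on a line, and two distinct points lie on at most one common line; points are collinear if some line contains both (so every point is collinear to itself). A subspace is a set of points that contains, with any two distinct collinear points, the line joining them; it is singular if its points are mutually collinear. A singular subspace has dimension $d$ if the least number of points spanning it is $d+1$ (so $\dim\emptyset=-1$). A *polar space* is a partial linear space in which every line has at least three points, no point is collinear to all points, for every point $p$ and line $L$ the point $p$ is collinear to exactly one or to all points of $L$, and every chain of distinct singular subspaces is finite; it has rank $n$ if all its maximal singular subspaces have dimension $n-1$. A *thin polar space* of rank $n$ is a partial linear space isomorphic to the one with point set $\{\pm1,\dots,\pm n\}$ whose lines are the two-element subsets $\{i,j\}$ with $j\neq -i$. For a (thin) polar space $\Pi$ of rank $n$ and $0\le k\le n-1$, the graph $\Gamma_k(\Pi)$ has as vertices the $k$-dimensional singular subspaces of $\Pi$. Two distinct vertices are adjacent if they lie in a common $(k+1)$-dimensional singular subspace when $k\le n-2$, and if their intersection is $(n-2)$-dimensional when $k=n-1$. For a singular subspace $S$, $[S\rangle_k$ is the set of all $k$-dimensional singular subspaces containing $S$. If $\dim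 S=m-1$, then $\Pi_S$ is the geometry with point set $[S\rangle_m$ whose lines are the sets $\{X\in[S\rangle_m : X\subset U\}$ for $U\in[S\rangle_{m+1}$. The $i$-dimensional singular subspace $\{X\in[S\rangle_m : X\subset U\}$ of $\Pi_S$ is identified with $U\in[S\rangle_{m+i}$. A collinearity preserving injection is an injective map of points that sends collinear points to collinear points and non-collinear points to non-collinear points. An isometric embedding of graphs is an injection of the vertex sets that preserves adjacency, non-adjacency and distance. **Theorem.** Let $\Pi$ be a polar space or a thin polar space of rank $n\ge 5$, let $\Pi'$ be a polar space of rank $n'$, let $1\le k\le n-4$ and $0\le k'\le n'-1$, and let $f$ be an isometric embedding of $\Gamma_k(\Pi)$ in $\Gamma_{k'}(\Pi')$. Then $$k\le k',\qquad n-k\le n'-k',$$ and there is a $(k'-k-1)$-dimensional singular subspace $S$ of $\Pi'$ such that the image of $f$ is contained in $[S\rangle_{k'}$ and $f$ is induced by a collinearity preserving injection $\alpha$ of $\Pi$ to $\Pi'_S$; that is, for every $k$-dimensional singular subspace $X$ of $\Pi$, the subspace of $\Pi'_S$ spanned by $\alpha(X)$ is the $k$-dimensional singular subspace of $\Pi'_S$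 identified with $f(X)$, namely the set of all $Y\in[S\rangle_{k'-k}$ with $Y\subset f(X)$. -/

import Mathlib

universe u v

/-- A point-line geometry on the point type `P`: a family of sets of points, called lines.
No law is built in; partial linear spaces and polar spaces are singled out by predicates. -/
structure PointLineGeometry (P : Type u) where
  lines : Set (Set P)

namespace PointLineGeometry

variable {P : Type u}

/-- Some line contains both points. In a partial linear space every point lies on a line, so
there every point is collinear to itself. -/
def Collinear (G : PointLineGeometry P) (p q : P) : Prop :=
  ∃ L ∈ G.lines, p ∈ L ∧ q ∈ L

structure IsPartialLinearSpace (G : PointLineGeometry P) : Prop where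
  nonempty : Nonempty P
  line_ne_univ : ∀ L ∈ G.lines, L ≠ Set.univ
  line_nontrivial : ∀ L ∈ G.lines, L.Nontrivial
  exists_line : ∀ p, ∃ L ∈ G.lines, p ∈ L
  line_unique : ∀ p q, p ≠ q → ∀ L ∈ G.lines, ∀ M ∈ G.lines,
    p ∈ L → q ∈ L → p ∈ M → q ∈ M → L = M

/-- A set of points containing, with any two distinct collinear points, the line joining them. -/
def IsSubspace (G : PointLineGeometry P) (S : Set P) : Prop :=
  ∀ p ∈ S, ∀ q ∈ S, p ≠ q → ∀ L ∈ G.lines, p ∈ L → q ∈ L → L ⊆ S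

/-- A subspace whose points are mutually collinear. -/
def IsSingular (G : PointLineGeometry P) (S : Set P) : Prop :=
  G.IsSubspace S ∧ ∀ p ∈ S, ∀ q ∈ S, p ≠ q → G.Collinear p q

/-- The smallest subspace containing `X`. -/
def span (G : PointLineGeometry P) (X : Set P) : Set P :=
  ⋂₀ {T | G.IsSubspace T ∧ X ⊆ T}

/-- `S` has (projective) dimension `d`: the least number of points that span `S` is `d + 1`.
The empty set has dimension `-1`, points have dimension `0`, lines have dimension `1`. -/
def HasDim (G : PointLineGeometry P) (S : Set P) (d : ℤ) : Prop :=
  IsLeast {m : ℤ | ∃ X : Finset P, G.span (X : Set P) = S ∧ m = (X.card : ℤ) - 1} d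

structure IsPolarSpace (G : PointLineGeometry P) : Prop extends G.IsPartialLinearSpace where
  three_le_line : ∀ L ∈ G.lines, 3 ≤ L.encard
  not_collinear_all : ¬ ∃ p, ∀ q, G.Collinear p q
  one_or_all : ∀ p, ∀ L ∈ G.lines,
    (∃! q, q ∈ L ∧ G.Collinear p q) ∨ ∀ q ∈ L, G.Collinear p q
  finite_chain : ∀ C : Set (Set P), (∀ S ∈ C, G.IsSingular S) →
    IsChain (· ⊆ ·) C → C.Finite

/-- All maximal singular subspaces have dimension `n - 1`. -/
def HasRank (G : PointLineGeometry P) (n : ℕ) : Prop :=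
  ∀ M, Maximal G.IsSingular M → G.HasDim M ((n : ℤ) - 1)

/-- The standard thin polar space on `{±1, …, ±n}`: the pairs `(i, true)` and `(i, false)` stand
for the two opposite points `±i`, and the lines are the two-element sets of non-opposite points. -/
def standardThin (n : ℕ) : PointLineGeometry (Fin n × Bool) where
  lines := {L | ∃ x y : Fin n × Bool, x.1 ≠ y.1 ∧ L = {x, y}}

/-- Isomorphic, by a collineation, to the standard thin polar space of rank `n`. -/
def IsThinPolarSpace (G : PointLineGeometry P) (n : ℕ) : Prop :=
  ∃ α : P ≃ Fin n × Bool, (fun L => α '' L) '' G.lines = (standardThin n).lines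

/-- The set of `k`-dimensional singular subspaces. -/
def grassmannian (G : PointLineGeometry P) (k : ℤ) : Set (Set P) :=
  {S | G.IsSingular S ∧ G.HasDim S k}

/-- The Grassmann graph of the `k`-dimensional singular subspaces of a space of rank `n`. For
`k ≤ n - 2` distinct vertices are adjacent if a `(k+1)`-dimensional singular subspace contains
both; for `k = n - 1` if their intersection is `(k-1)`-dimensional. -/
def grassmannGraph (G : PointLineGeometry P) (n : ℕ) (k : ℤ) :
    SimpleGraph (G.grassmannian k) where
  Adj X Y := X ≠ Y ∧
    ((k ≤ (n : ℤ) - 2 ∧ ∃ U ∈ G.grassmannian (k + 1), X.1 ⊆ U ∧ Y.1 ⊆ U) ∨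
      (k = (n : ℤ) - 1 ∧ G.HasDim (X.1 ∩ Y.1) (k - 1)))
  symm := ⟨by
    rintro X Y ⟨hne, ⟨hk, U, hU, hX, hY⟩ | ⟨hk, h⟩⟩
    · exact ⟨hne.symm, Or.inl ⟨hk, U, hU, hY, hX⟩⟩
    · exact ⟨hne.symm, Or.inr ⟨hk, by rwa [Set.inter_comm]⟩⟩⟩
  loopless := ⟨fun _ h => h.1 rfl⟩

/-- The set `[S⟩_k` of all `k`-dimensional singular subspaces containing `S`. -/
def bigStar (G : PointLineGeometry P) (S : Set P) (k : ℤ) : Set (G.grassmannian k) :=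
  {X | S ⊆ X.1}

/-- The points of the quotient by `S`: the singular subspaces that contain `S` and have
dimension `dim S + 1`. -/
def quotientPoints (G : PointLineGeometry P) (S : Set P) : Set (Set P) :=
  {X | S ⊆ X ∧ ∃ d, G.HasDim S d ∧ X ∈ G.grassmannian (d + 1)}

/-- The quotient by `S`. Its lines are the sets of all points `X` with `S ⊆ X ⊆ U`, where `U` is a
singular subspace of dimension `dim S + 2` that contains `S`. -/
def quotient (G : PointLineGeometry P) (S : Set P) :
    PointLineGeometry (G.quotientPoints S) where
  lines := {L | ∃ d, G.HasDim S d ∧ ∃ U ∈ G.grassmannian (d + 2), S ⊆ U ∧ L = {X | X.1 ⊆ U}}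

/-- A collinearity preserving injection: collinear points go to collinear points and
non-collinear points go to non-collinear points. -/
structure IsCollinearityPreservingInjection {Q : Type v} (G : PointLineGeometry P)
    (H : PointLineGeometry Q) (α : P → Q) : Prop where
  injective : Function.Injective α
  collinear_iff : ∀ p q, H.Collinear (α p) (α q) ↔ G.Collinear p q

/-- The map `f` from `k`-dimensional singular subspaces of `G` to `k'`-dimensional ones of `H` is
induced by the map `α` from the points of `G` to the points of the quotient of `H` by `S`: the
subspace of the quotient spanned by `α(X)` consists of the points `Y` with `S ⊆ Y ⊆ f(X)`; this
set is the singular subspace of the quotient that is identified with `f(X)`. -/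
def IsInducedBy {Q : Type v} (G : PointLineGeometry P) (H : PointLineGeometry Q) {k k' : ℤ}
    (f : G.grassmannian k → H.grassmannian k') (S : Set Q) (α : P → H.quotientPoints S) : Prop :=
  ∀ X : G.grassmannian k, (H.quotient S).span (α '' X.1) = {Y | Y.1 ⊆ (f X).1}

end PointLineGeometry

/-! ### Spans, perps and residues -/

namespace PointLineGeometry

variable {P : Type u} {G : PointLineGeometry P}

/-! The embedding is pushed down one rank at a time, from k-dimensional subspaces to points. Fix a
singular subspace R of rank one less than the objects on which the current map F is defined. The
objects containing R form a connected residue with collinear and noncollinear pairs. Pairwise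
adjacent images either share a hyperplane or lie in a common subspace of the next rank. The second
alternative spreads over a connected residue, and it would make images of noncollinear points
adjacent. So all images of objects containing R share a hyperplane, the star image of R
(`starMap_spec`). The connectedness used here is the reason for k ≤ n − 4.

The star images define a map one rank lower. It is again a local embedding if it separates any two
subspaces S, T with a common hyperplane, and this is where distances are used. The distance of two
vertices X, Y is at most one more than the codimension of X ∩ Y in X (`edist_le`), and it exceeds
this codimension when X and Y are opposite over X ∩ Y (`lt_edist_of_oppositeOver`). Extend S and T
to vertices opposite over S ∩ T (`exists_oppositeOver`). If the star images of S and T were equal,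
the images of these vertices would share too large a subspace to be so far apart (`IsDescent.succ`).

At rank 1 the map sends points to subspaces that share a hyperplane S, that is, to points of the
quotient by S. It preserves and reflects collinearity. Since f(X) remains spanned by the images of
the subspaces of X throughout the descent, f is induced by this map. The inequality n − k ≤ n' − k'
holds because a maximal singular subspace of rank n produces a singular subspace of rank at least rk
S + n.

A target with k' = n' − 1 is excluded beforehand (`not_maximal_of_embedding`). Polar and thin polar
spaces are treated together through the axioms `IsPerpSpace`, which do not mention the number of
points on a line. -/

theorem Collinear.symm {p q : P} (h : G.Collinear p q) : G.Collinear q p := by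
  obtain ⟨L, hL, hp, hq⟩ := h
  exact ⟨L, hL, hq, hp⟩

theorem subset_span (X : Set P) : X ⊆ G.span X := fun _ hx _ hT => hT.2 hx

theorem span_subset {X T : Set P} (hT : G.IsSubspace T) (h : X ⊆ T) : G.span X ⊆ T :=
  fun _ hx => hx T ⟨hT, h⟩

theorem isSubspace_span (X : Set P) : G.IsSubspace (G.span X) := by
  intro p hp q hq hpq L hL hpL hqL x hx T hT
  exact hT.1 p (hp T hT) q (hq T hT) hpq L hL hpL hqL hx

theorem span_mono {X Y : Set P} (h : X ⊆ Y) : G.span X ⊆ G.span Y :=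
  span_subset (isSubspace_span Y) (h.trans (subset_span Y))

theorem IsSubspace.span_eq {X : Set P} (h : G.IsSubspace X) : G.span X = X :=
  (span_subset h subset_rfl).antisymm (subset_span X)

theorem isSubspace_empty : G.IsSubspace ∅ := fun _ h => h.elim

theorem IsSubspace.inter {X Y : Set P} (hX : G.IsSubspace X) (hY : G.IsSubspace Y) :
    G.IsSubspace (X ∩ Y) := fun p hp q hq hpq L hL hpL hqL =>
  Set.subset_inter (hX p hp.1 q hq.1 hpq L hL hpL hqL) (hY p hp.2 q hq.2 hpq L hL hpL hqL)

theorem span_insert_span (p : P) (X : Set P) :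
    G.span (insert p (G.span X)) = G.span (insert p X) := by
  apply Set.Subset.antisymm
  · apply span_subset (isSubspace_span _)
    rintro x (rfl | hx)
    · exact subset_span _ (Set.mem_insert _ _)
    · exact span_mono (Set.subset_insert p X) hx
  · exact span_mono (Set.insert_subset_insert (subset_span X))

/-- All points of `A` are collinear to all points of `B`. -/
def Perp (G : PointLineGeometry P) (A B : Set P) : Prop :=
  ∀ a ∈ A, ∀ b ∈ B, G.Collinear a b

theorem Perp.symm {A B : Set P} (h : G.Perp A B) : G.Perp B A :=
  fun b hb a ha => (h a ha b hb).symm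

theorem Perp.mono {A B A' B' : Set P} (h : G.Perp A B) (hA : A' ⊆ A) (hB : B' ⊆ B) :
    G.Perp A' B' := fun a ha b hb => h a (hA ha) b (hB hb)

/-- The points outside `N` that are collinear to all points of `N`. -/
def residue (G : PointLineGeometry P) (N : Set P) : Set P :=
  {p | p ∉ N ∧ ∀ x ∈ N, G.Collinear p x}

/-- The subspace spanned by `N` and `p`. -/
def adjoin (G : PointLineGeometry P) (N : Set P) (p : P) : Set P :=
  G.span (insert p N)

theorem subset_adjoin (N : Set P) (p : P) : N ⊆ G.adjoin N p :=
  (Set.subset_insert p N).trans (subset_span _)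

theorem mem_adjoin (N : Set P) (p : P) : p ∈ G.adjoin N p :=
  subset_span _ (Set.mem_insert p N)

theorem isSubspace_adjoin (N : Set P) (p : P) : G.IsSubspace (G.adjoin N p) :=
  isSubspace_span _

theorem adjoin_subset {N T : Set P} {p : P} (hT : G.IsSubspace T) (h : N ⊆ T) (hp : p ∈ T) :
    G.adjoin N p ⊆ T :=
  span_subset hT (Set.insert_subset hp h)

/-! ### Common axioms for polar and thin polar spaces -/

/-- The axioms shared by polar spaces and thin polar spaces: nothing is asked of the number of
points on a line. -/
structure IsPerpSpace (G : PointLineGeometry P) : Prop where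
  exists_line : ∀ p, ∃ L ∈ G.lines, p ∈ L
  exists_collinear : ∀ p, ∀ L ∈ G.lines, ∃ q ∈ L, G.Collinear p q
  collinear_line : ∀ p, ∀ L ∈ G.lines, ∀ q ∈ L, ∀ r ∈ L, q ≠ r →
    G.Collinear p q → G.Collinear p r → ∀ s ∈ L, G.Collinear p s
  exists_not_collinear : ∀ p, ∃ q, ¬ G.Collinear p q
  finite_chain : ∀ C : Set (Set P), (∀ S ∈ C, G.IsSingular S) →
    IsChain (· ⊆ ·) C → C.Finite

/-- A subspace none of whose points is collinear to all of its points. -/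
def IsNondegenerate (G : PointLineGeometry P) (R : Set P) : Prop :=
  G.IsSubspace R ∧ ∀ p ∈ R, ∃ q ∈ R, ¬ G.Collinear p q

/-- The rank of a subspace, read off from a chain of subspaces each of which is spanned by its
predecessor and one more point. -/
inductive HasChainRank (G : PointLineGeometry P) : Set P → ℕ → Prop
  | empty : HasChainRank G ∅ 0
  | adjoin {N : Set P} {m : ℕ} {p : P} (hN : HasChainRank G N m) (hp : p ∈ G.residue N) :
      HasChainRank G (G.adjoin N p) (m + 1)

open Classical in
/-- The rank of a singular subspace: one more than its dimension. -/
noncomputable def rk (G : PointLineGeometry P) (N : Set P) : ℕ :=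
  if h : ∃ m, G.HasChainRank N m then h.choose else 0

theorem IsSingular.inter {X H : Set P} (hX : G.IsSingular X) (hH : G.IsSubspace H) :
    G.IsSingular (X ∩ H) :=
  ⟨hX.1.inter hH, fun p hp q hq => hX.2 p hp.1 q hq.1⟩

/-- If every line of the singular subspace `X` meets the subspace `H`, then `X ∩ H` and any point
of `X` outside `H` span `X`. -/
theorem IsSingular.adjoin_inter_eq {X H : Set P} {p : P} (hX : G.IsSingular X)
    (h : ∀ L ∈ G.lines, L ⊆ X → ∃ x ∈ L, x ∈ H) (hp : p ∈ X) (hpH : p ∉ H) :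
    G.adjoin (X ∩ H) p = X := by
  refine (adjoin_subset hX.1 Set.inter_subset_left hp).antisymm fun y hy => ?_
  by_cases hyp : p = y
  · exact hyp ▸ mem_adjoin _ _
  obtain ⟨L, hL, hpL, hyL⟩ := hX.2 p hp y hy hyp
  have hLX := hX.1 p hp y hy hyp L hL hpL hyL
  obtain ⟨x, hxL, hxH⟩ := h L hL hLX
  have hxp : x ≠ p := by
    rintro rfl
    exact hpH hxH
  exact isSubspace_adjoin _ _ x (subset_adjoin (X ∩ H) _ ⟨hLX hxL, hxH⟩) p (mem_adjoin _ _) hxp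
    L hL hxL hpL hyL

namespace IsPerpSpace

theorem refl (hG : G.IsPerpSpace) (p : P) : G.Collinear p p := by
  obtain ⟨L, hL, hp⟩ := hG.exists_line p
  exact ⟨L, hL, hp, hp⟩

theorem isSubspace_perp (hG : G.IsPerpSpace) (p : P) : G.IsSubspace {x | G.Collinear p x} :=
  fun q hq r hr hqr L hL hqL hrL s hs => hG.collinear_line p L hL q hqL r hrL hqr hq hr s hs

theorem perp_span (hG : G.IsPerpSpace) {p : P} {X : Set P} (h : ∀ x ∈ X, G.Collinear p x) :
    ∀ x ∈ G.span X, G.Collinear p x :=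
  fun _ hx => span_subset (hG.isSubspace_perp p) h hx

theorem perp_adjoin (hG : G.IsPerpSpace) {p b : P} {N : Set P} (h : ∀ x ∈ N, G.Collinear p x)
    (hb : G.Collinear p b) : ∀ x ∈ G.adjoin N b, G.Collinear p x := by
  apply hG.perp_span
  rintro x (rfl | hx)
  exacts [hb, h x hx]

theorem span_perp_span (hG : G.IsPerpSpace) {X Y : Set P} (h : G.Perp X Y) :
    G.Perp (G.span X) (G.span Y) := by
  intro a ha b hb
  refine (hG.perp_span (X := X) (fun x hx => ?_) a ha).symm
  exact (hG.perp_span (X := Y) (fun y hy => h x hx y hy) b hb).symm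

theorem perp_self (hG : G.IsPerpSpace) {X : Set P} (h : G.IsSingular X) : G.Perp X X := by
  intro a ha b hb
  by_cases hab : a = b
  · exact hab ▸ hG.refl a
  · exact h.2 a ha b hb hab

theorem isSingular_span (hG : G.IsPerpSpace) {X : Set P} (h : G.Perp X X) :
    G.IsSingular (G.span X) :=
  ⟨isSubspace_span X, fun p hp q hq _ => hG.span_perp_span h p hp q hq⟩

theorem perp_insert (hG : G.IsPerpSpace) {N : Set P} {p : P} (hN : G.Perp N N)
    (hp : ∀ x ∈ N, G.Collinear p x) : G.Perp (insert p N) (insert p N) := by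
  rintro a (rfl | ha) b (rfl | hb)
  exacts [hG.refl _, hp b hb, (hp a ha).symm, hN a ha b hb]

theorem isSingular_adjoin (hG : G.IsPerpSpace) {N : Set P} {p : P} (hN : G.IsSingular N)
    (hp : ∀ x ∈ N, G.Collinear p x) : G.IsSingular (G.adjoin N p) :=
  hG.isSingular_span (hG.perp_insert (hG.perp_self hN) hp)

/-! ### Separating a point from a singular subspace by a perp -/

/-- Distinct points of a nondegenerate subspace have incomparable perps. -/
theorem exists_collinear_not_collinear (hG : G.IsPerpSpace) {R : Set P}
    (hR : G.IsNondegenerate R) {b y : P} (hb : b ∈ R) (hy : y ∈ R) (hby : b ≠ y) :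
    ∃ w ∈ R, G.Collinear w b ∧ ¬ G.Collinear w y := by
  by_contra! hcon
  obtain ⟨L, hL, hbL, hyL⟩ := hcon b hb (hG.refl b)
  have hLR : L ⊆ R := hR.1 b hb y hy hby L hL hbL hyL
  have h1 : ∀ w ∈ R, G.Collinear w b → ∀ x ∈ L, G.Collinear w x := fun w hw hwb =>
    hG.collinear_line w L hL b hbL y hyL hby hwb (hcon w hw hwb)
  -- For u not collinear to b and t on L collinear to u, every point of R collinear to u is
  -- collinear to t: each line through u and such a point meets the perp of b, hence by `h1`
  -- contains a second point collinear to t.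
  have h2 : ∀ u ∈ R, ¬ G.Collinear u b → ∀ t ∈ L, G.Collinear u t →
      ∀ w ∈ R, G.Collinear w u → G.Collinear w t := by
    intro u hu hub t ht hut w hw hwu
    by_cases hne : w = u
    · exact hne ▸ hut
    obtain ⟨M, hM, hwM, huM⟩ := hwu
    obtain ⟨x, hxM, hx⟩ := hG.exists_collinear b M hM
    have hxR : x ∈ R := hR.1 w hw u hu hne M hM hwM huM hxM
    have hxu : x ≠ u := by
      rintro rfl
      exact hub hx.symm
    exact (hG.collinear_line t M hM x hxM u huM hxu (h1 x hxR hx.symm t ht).symm hut.symm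
      w hwM).symm
  obtain ⟨u₁, hu₁, hbu₁⟩ := hR.2 b hb
  obtain ⟨t, ht, hut⟩ := hG.exists_collinear u₁ L hL
  obtain ⟨u₂, hu₂, htu₂⟩ := hR.2 t (hLR ht)
  have hu₁t : u₁ ≠ t := by
    rintro rfl
    exact hbu₁ ⟨L, hL, hbL, ht⟩
  obtain ⟨M, hM, huM, htM⟩ := hut
  have hMR : M ⊆ R := hR.1 _ hu₁ _ (hLR ht) hu₁t M hM huM htM
  obtain ⟨x, hxM, hx⟩ := hG.exists_collinear u₂ M hM
  have hxt : x ≠ t := by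
    rintro rfl
    exact htu₂ hx.symm
  -- Otherwise b would be collinear to x and t, hence to u₁. So `h2` applies to x and makes u₂
  -- collinear to t, a contradiction.
  have hxb : ¬ G.Collinear x b := fun h => hbu₁
    (hG.collinear_line b M hM x hxM t htM hxt h.symm ⟨L, hL, hbL, ht⟩ u₁ huM)
  exact htu₂ (h2 x (hMR hxM) hxb t ht ⟨M, hM, hxM, htM⟩ u₂ hu₂ hx).symm

/-- Given y in the perp of b and z, a point w collinear to b but not to y is moved along the line wb
to its point collinear to z. This point is not collinear to y, since otherwise y would be collinear
to b and to it, hence to w. -/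
theorem isNondegenerate_perp_pair (hG : G.IsPerpSpace) {R : Set P}
    (hR : G.IsNondegenerate R) {b z : P} (hb : b ∈ R) (hbz : ¬ G.Collinear z b) :
    G.IsNondegenerate {x ∈ R | G.Collinear b x ∧ G.Collinear z x} := by
  refine ⟨hR.1.inter ((hG.isSubspace_perp b).inter (hG.isSubspace_perp z)), ?_⟩
  rintro y ⟨hy, hby, hzy⟩
  have hne : b ≠ y := by
    rintro rfl
    exact hbz hzy
  obtain ⟨w, hw, hwb, hwy⟩ := hG.exists_collinear_not_collinear hR hb hy hne
  obtain ⟨L, hL, hwL, hbL⟩ := id hwb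
  have hwb' : w ≠ b := by
    rintro rfl
    exact hwy hby
  obtain ⟨x, hxL, hzx⟩ := hG.exists_collinear z L hL
  have hxb : x ≠ b := by
    rintro rfl
    exact hbz hzx
  refine ⟨x, ⟨hR.1 w hw b hb hwb' L hL hwL hbL hxL, ⟨L, hL, hbL, hxL⟩, hzx⟩, fun h => hwy ?_⟩
  exact (hG.collinear_line y L hL x hxL b hbL hxb h hby.symm w hwL).symm

/-- Induction along the chain, with R allowed to shrink. A point z separates N from the last
generator b. The induction hypothesis is then used in the nondegenerate subspace of points of R
collinear to b and z, with p replaced by the point of the line pb collinear to z. -/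
theorem separation_of_hasChainRank (hG : G.IsPerpSpace) {N : Set P} {m : ℕ}
    (hN : G.HasChainRank N m) : ∀ {R : Set P}, G.IsNondegenerate R → N ⊆ R → ∀ p ∈ R,
      p ∈ G.residue N → ∃ q ∈ R, (∀ x ∈ N, G.Collinear q x) ∧ ¬ G.Collinear q p := by
  induction hN with
  | empty =>
    intro R hR _ p hp _
    obtain ⟨q, hq, hpq⟩ := hR.2 p hp
    exact ⟨q, hq, by simp, fun h => hpq h.symm⟩
  | @adjoin N m b hN hb ih =>
    intro R hR hNR p hp hpN
    have hbR := hNR (mem_adjoin N b)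
    have hN0 := (subset_adjoin (G := G) N b)
    obtain ⟨z, hz, hzN, hzb⟩ := ih hR (hN0.trans hNR) b hbR hb
    have hpb : p ≠ b := by
      rintro rfl
      exact hpN.1 (mem_adjoin N _)
    obtain ⟨L, hL, hpL, hbL⟩ := hpN.2 b (mem_adjoin N b)
    obtain ⟨y, hyL, hzy⟩ := hG.exists_collinear z L hL
    have hyb : y ≠ b := by
      rintro rfl
      exact hzb hzy
    have hyR : y ∈ R := hR.1 p hp b hbR hpb L hL hpL hbL hyL
    have hyN : y ∈ G.residue N := by
      refine ⟨fun h => hpN.1 ?_, fun x hx => ?_⟩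
      · exact isSubspace_adjoin N b y (hN0 h) b (mem_adjoin N b) hyb L hL hyL hbL hpL
      · exact (hG.collinear_line x L hL p hpL b hbL hpb (hpN.2 x (hN0 hx)).symm
          (hb.2 x hx).symm y hyL).symm
    obtain ⟨w, hw, hwN, hwy⟩ := ih (hG.isNondegenerate_perp_pair hR hbR hzb)
      (fun x hx => ⟨hNR (hN0 hx), hb.2 x hx, hzN x hx⟩) y ⟨hyR, ⟨L, hL, hbL, hyL⟩, hzy⟩ hyN
    refine ⟨w, hw.1, hG.perp_adjoin hwN hw.2.1.symm, fun h => hwy ?_⟩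
    exact hG.collinear_line w L hL p hpL b hbL hpb h hw.2.1.symm y hyL

/-! ### The rank of singular subspaces -/

theorem wellFounded_supset (hG : G.IsPerpSpace) :
    WellFounded (fun A B : {S // G.IsSingular S} => B.1 ⊂ A.1) := by
  have : IsStrictOrder {S // G.IsSingular S} (fun A B => B.1 ⊂ A.1) :=
    { irrefl := fun A h => h.ne rfl, trans := fun A B C h h' => h'.trans h }
  rw [RelEmbedding.wellFounded_iff_isEmpty]
  constructor
  intro e
  have hmono : StrictMono (fun i => (e i).1) := fun i j h => e.map_rel_iff.2 h
  refine Set.infinite_range_of_injective hmono.injective (hG.finite_chain _ ?_ ?_)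
  · rintro _ ⟨i, rfl⟩
    exact (e i).2
  · rintro _ ⟨i, rfl⟩ _ ⟨j, rfl⟩ _
    exact (le_total i j).imp (fun h => hmono.monotone h) (fun h => hmono.monotone h)

theorem exists_maximal (hG : G.IsPerpSpace) (p : Set P → Prop) (hp : ∀ S, p S → G.IsSingular S)
    {A : Set P} (hA : p A) : ∃ M, p M ∧ A ⊆ M ∧ ∀ B, p B → M ⊆ B → B = M := by
  obtain ⟨M, hM, hmin⟩ := hG.wellFounded_supset.has_min {S | p S.1 ∧ A ⊆ S.1}
    ⟨⟨A, hp A hA⟩, hA, subset_rfl⟩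
  refine ⟨M.1, hM.1, hM.2, fun B hB hMB => ?_⟩
  by_contra hne
  exact hmin ⟨B, hp B hB⟩ ⟨hB, hM.2.trans hMB⟩ (hMB.ssubset_of_ne (Ne.symm hne))

theorem isSingular_of_hasChainRank (hG : G.IsPerpSpace) {N : Set P} {m : ℕ}
    (hN : G.HasChainRank N m) : G.IsSingular N := by
  induction hN with
  | empty => exact ⟨isSubspace_empty, fun _ h => h.elim⟩
  | adjoin hN hp ih => exact hG.isSingular_adjoin ih hp.2

theorem mem_residue_of_mem (hG : G.IsPerpSpace) {N M : Set P} {p : P} (hM : G.IsSingular M)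
    (h : N ⊆ M) (hp : p ∈ M) (hpN : p ∉ N) : p ∈ G.residue N :=
  ⟨hpN, fun x hx => hG.perp_self hM p hp x (h hx)⟩

/-- A maximal subspace of N reached by a chain is N itself, since any further point of N would
prolong the chain. -/
theorem exists_hasChainRank (hG : G.IsPerpSpace) {N : Set P} (hN : G.IsSingular N) :
    ∃ m, G.HasChainRank N m := by
  obtain ⟨M, ⟨hMN, m, hm⟩, _, hmax⟩ := hG.exists_maximal
    (fun S => S ⊆ N ∧ ∃ m, G.HasChainRank S m)
    (fun S hS => hG.isSingular_of_hasChainRank hS.2.choose_spec) (A := ∅)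
    ⟨Set.empty_subset N, 0, .empty⟩
  suffices M = N from ⟨m, this ▸ hm⟩
  refine hMN.antisymm fun x hx => ?_
  by_contra hxM
  refine hxM ?_
  rw [← hmax (G.adjoin M x) ⟨adjoin_subset hN.1 hMN hx, m + 1, .adjoin hm
    (hG.mem_residue_of_mem hN hMN hx hxM)⟩ (subset_adjoin M x)]
  exact mem_adjoin M x

theorem isNondegenerate_univ (hG : G.IsPerpSpace) : G.IsNondegenerate Set.univ :=
  ⟨fun _ _ _ _ _ _ _ _ _ => Set.subset_univ _, fun p _ =>
    (hG.exists_not_collinear p).imp fun _ h => ⟨trivial, h⟩⟩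

/-- A singular subspace `N` is cut out of `⟨N, p⟩` by the perp of a point. -/
theorem separation (hG : G.IsPerpSpace) {N : Set P} {p : P} (hN : G.IsSingular N)
    (hp : p ∈ G.residue N) : ∃ q, (∀ x ∈ N, G.Collinear q x) ∧ ¬ G.Collinear q p ∧
      ∀ x ∈ G.adjoin N p, G.Collinear q x → x ∈ N := by
  obtain ⟨m, hm⟩ := hG.exists_hasChainRank hN
  obtain ⟨q, _, hqN, hqp⟩ := hG.separation_of_hasChainRank hm hG.isNondegenerate_univ
    (Set.subset_univ _) p trivial hp
  refine ⟨q, hqN, hqp, fun x hx hqx => ?_⟩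
  by_contra hxN
  have hS := hG.isSingular_adjoin hN hp.2
  have hpx := hG.perp_self hS p (mem_adjoin N p) x hx
  -- If x were outside N, some w collinear to N, p and q would fail to be collinear to x; but being
  -- collinear to N and p, it is collinear to all of their span.
  obtain ⟨w, hw, hwN, hwx⟩ := hG.separation_of_hasChainRank hm
    (hG.isNondegenerate_perp_pair hG.isNondegenerate_univ trivial hqp)
    (fun y hy => ⟨trivial, hp.2 y hy, hqN y hy⟩) x ⟨trivial, hpx, hqx⟩
    (hG.mem_residue_of_mem hS (subset_adjoin N p) hx hxN)
  exact hwx (hG.perp_adjoin hwN hw.2.1.symm x hx)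

/-- A singular subspace is a hyperplane of the span with one more point. -/
theorem line_meets (hG : G.IsPerpSpace) {N : Set P} {p : P} (hN : G.IsSingular N)
    (hp : p ∈ G.residue N) {L : Set P} (hL : L ∈ G.lines) (h : L ⊆ G.adjoin N p) :
    ∃ x ∈ L, x ∈ N := by
  obtain ⟨q, _, _, hq⟩ := hG.separation hN hp
  obtain ⟨x, hx, hqx⟩ := hG.exists_collinear q L hL
  exact ⟨x, hx, hq x (h hx) hqx⟩

theorem adjoin_eq_of_mem (hG : G.IsPerpSpace) {N : Set P} {p x : P} (hN : G.IsSingular N)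
    (hp : p ∈ G.residue N) (hx : x ∈ G.adjoin N p) (hxN : x ∉ N) :
    G.adjoin N x = G.adjoin N p := by
  have := (hG.isSingular_adjoin hN hp.2).adjoin_inter_eq
    (fun L hL h => hG.line_meets hN hp hL h) hx hxN
  rwa [Set.inter_eq_right.2 (subset_adjoin N p)] at this

/-- A Jordan–Hölder argument: the last members A and B of two chains are hyperplanes of the same
subspace. If they differ, A ∩ B is a hyperplane of both, and the induction hypothesis compares the
chains through it. -/
theorem hasChainRank_unique (hG : G.IsPerpSpace) {m : ℕ} : ∀ {N : Set P} {m' : ℕ},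
    G.HasChainRank N m → G.HasChainRank N m' → m = m' := by
  induction m with
  | zero =>
    intro N m' h h'
    cases h
    generalize hE : (∅ : Set P) = E at h'
    cases h' with
    | empty => rfl
    | adjoin hN hp => exact absurd (hE ▸ mem_adjoin _ _) (Set.notMem_empty _)
  | succ m ih =>
    intro N m' h h'
    cases h with
    | @adjoin A _ a hA ha =>
    generalize hE : G.adjoin A a = E at h'
    cases h' with
    | empty => exact absurd (hE ▸ mem_adjoin A a) (Set.notMem_empty _)
    | @adjoin B m' b hB hb =>
    have sA := hG.isSingular_of_hasChainRank hA
    have sB := hG.isSingular_of_hasChainRank hB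
    by_cases hAB : A ⊆ B
    · by_cases hBA : B ⊆ A
      · obtain rfl := hAB.antisymm hBA
        rw [ih hA hB]
      · exfalso
        obtain ⟨x, hxB, hxA⟩ := Set.not_subset.1 hBA
        have h1 := hG.adjoin_eq_of_mem sA ha (hE ▸ subset_adjoin B b hxB) hxA
        have : G.adjoin A a ⊆ B := h1 ▸ adjoin_subset sB.1 hAB hxB
        exact hb.1 (this (hE ▸ mem_adjoin B b))
    · obtain ⟨x, hxA, hxB⟩ := Set.not_subset.1 hAB
      have hBA : ¬ B ⊆ A := by
        intro hBA
        have h1 := hG.adjoin_eq_of_mem sB hb (hE ▸ subset_adjoin A a hxA) hxB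
        have : G.adjoin B b ⊆ A := h1 ▸ adjoin_subset sA.1 hBA hxA
        exact ha.1 (this (hE ▸ mem_adjoin A a))
      obtain ⟨y, hyB, hyA⟩ := Set.not_subset.1 hBA
      obtain ⟨c, hc⟩ := hG.exists_hasChainRank (sA.inter sB.1)
      have eA := sA.adjoin_inter_eq (H := B) (fun L hL h => hG.line_meets sB hb hL
        (h.trans (hE ▸ subset_adjoin A a))) hxA hxB
      have eB := sB.adjoin_inter_eq (H := A) (fun L hL h => hG.line_meets sA ha hL
        (h.trans (hE ▸ subset_adjoin B b))) hyB hyA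
      have rA : G.HasChainRank A (c + 1) := eA ▸ .adjoin hc
        (hG.mem_residue_of_mem sA Set.inter_subset_left hxA fun h => hxB h.2)
      have rB : G.HasChainRank B (c + 1) := eB ▸ .adjoin (Set.inter_comm A B ▸ hc)
        (hG.mem_residue_of_mem sB Set.inter_subset_left hyB fun h => hyA h.2)
      have h1 := ih hA rA
      have h2 := ih (h1 ▸ rB) hB
      rw [h2]

theorem hasChainRank_rk (hG : G.IsPerpSpace) {N : Set P} (hN : G.IsSingular N) :
    G.HasChainRank N (G.rk N) := by
  have h := hG.exists_hasChainRank hN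
  rw [rk, dif_pos h]
  exact h.choose_spec

theorem rk_eq (hG : G.IsPerpSpace) {N : Set P} {m : ℕ} (h : G.HasChainRank N m) :
    G.rk N = m :=
  hG.hasChainRank_unique (hG.hasChainRank_rk (hG.isSingular_of_hasChainRank h)) h

theorem rk_empty (hG : G.IsPerpSpace) : G.rk ∅ = 0 := hG.rk_eq .empty

theorem rk_adjoin (hG : G.IsPerpSpace) {N : Set P} {p : P} (hN : G.IsSingular N)
    (hp : p ∈ G.residue N) : G.rk (G.adjoin N p) = G.rk N + 1 :=
  hG.rk_eq (.adjoin (hG.hasChainRank_rk hN) hp)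

/-- A subspace meeting all lines of `X` meets `X` in a subspace of rank at least `rk X - 1`. -/
theorem rk_le_rk_inter_succ (hG : G.IsPerpSpace) {X H : Set P} (hX : G.IsSingular X)
    (hH : G.IsSubspace H) (h : ∀ L ∈ G.lines, L ⊆ X → ∃ x ∈ L, x ∈ H) :
    G.rk X ≤ G.rk (X ∩ H) + 1 := by
  by_cases hXH : X ⊆ H
  · rw [Set.inter_eq_left.2 hXH]
    exact Nat.le_succ _
  obtain ⟨x, hx, hxH⟩ := Set.not_subset.1 hXH
  rw [← hG.rk_adjoin (hX.inter hH) (hG.mem_residue_of_mem hX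
    Set.inter_subset_left hx fun h => hxH h.2), hX.adjoin_inter_eq h hx hxH]

/-- The bound and its equality case go through the induction together: to recover N ⊆ M from equal
ranks, the equality case is needed for M ∩ N. -/
theorem rk_le_of_subset_aux (hG : G.IsPerpSpace) {N : Set P} {m : ℕ} (hN : G.HasChainRank N m) :
    ∀ M, G.IsSingular M → M ⊆ N → G.rk M ≤ m ∧ (m ≤ G.rk M → N ⊆ M) := by
  induction hN with
  | empty =>
    intro M _ hM
    rw [Set.subset_empty_iff.1 hM, hG.rk_empty]
    exact ⟨le_rfl, fun _ => subset_rfl⟩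
  | @adjoin N m p hN hp ih =>
    intro M hM hMN
    have sN := hG.isSingular_of_hasChainRank hN
    obtain ⟨h1, h2⟩ := ih _ (hM.inter sN.1) Set.inter_subset_right
    have h3 := hG.rk_le_rk_inter_succ hM sN.1 fun L hL h => hG.line_meets sN hp hL (h.trans hMN)
    refine ⟨by omega, fun h4 => ?_⟩
    have h5 : N ⊆ M := (h2 (by omega)).trans Set.inter_subset_left
    have h6 : ¬ M ⊆ N := by
      intro h6
      rw [h6.antisymm h5, hG.rk_eq hN] at h4
      omega
    obtain ⟨x, hxM, hxN⟩ := Set.not_subset.1 h6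
    rw [← hG.adjoin_eq_of_mem sN hp (hMN hxM) hxN]
    exact adjoin_subset hM.1 h5 hxM

theorem rk_mono (hG : G.IsPerpSpace) {M N : Set P} (hM : G.IsSingular M) (hN : G.IsSingular N)
    (h : M ⊆ N) : G.rk M ≤ G.rk N :=
  (hG.rk_le_of_subset_aux (hG.hasChainRank_rk hN) M hM h).1

theorem eq_of_subset_of_rk_le (hG : G.IsPerpSpace) {M N : Set P} (hM : G.IsSingular M)
    (hN : G.IsSingular N) (h : M ⊆ N) (hr : G.rk N ≤ G.rk M) : M = N :=
  h.antisymm ((hG.rk_le_of_subset_aux (hG.hasChainRank_rk hN) M hM h).2 hr)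

theorem _root_.PointLineGeometry.HasChainRank.exists_spanning {N : Set P} {m : ℕ} (h : G.HasChainRank N m) :
    ∃ X : Finset P, G.span (X : Set P) = N ∧ X.card = m := by
  classical
  induction h with
  | empty => exact ⟨∅, by simpa using isSubspace_empty.span_eq, rfl⟩
  | @adjoin N m p hN hp ih =>
    obtain ⟨X, rfl, rfl⟩ := ih
    refine ⟨insert p X, ?_, Finset.card_insert_of_notMem fun h => hp.1 (subset_span _ h)⟩
    rw [Finset.coe_insert, adjoin, span_insert_span]

theorem rk_span_le (hG : G.IsPerpSpace) (X : Finset P) (h : G.Perp (X : Set P) X) :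
    G.rk (G.span (X : Set P)) ≤ X.card := by
  classical
  induction X using Finset.induction_on with
  | empty => simp [isSubspace_empty.span_eq, hG.rk_empty]
  | insert p X hp ih =>
    rw [Finset.coe_insert] at h ⊢
    have hX : G.Perp (X : Set P) X := h.mono (Set.subset_insert _ _) (Set.subset_insert _ _)
    have hS := hG.isSingular_span hX
    rw [Finset.card_insert_of_notMem hp, ← span_insert_span]
    by_cases hm : p ∈ G.span (X : Set P)
    · rw [Set.insert_eq_of_mem hm, (isSubspace_span _).span_eq]
      exact (ih hX).trans (Nat.le_succ _)
    · have := hG.rk_adjoin hS ⟨hm, hG.perp_span fun x hx => h p (Set.mem_insert _ _) x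
        (Set.mem_insert_of_mem _ hx)⟩
      rw [adjoin] at this
      rw [this]
      exact Nat.succ_le_succ (ih hX)

/-- A chain provides `rk N` spanning points, and `rk_span_le` shows that fewer cannot span. This
turns dimensions into natural number ranks. -/
theorem hasDim_iff (hG : G.IsPerpSpace) {N : Set P} (hN : G.IsSingular N) {d : ℤ} :
    G.HasDim N d ↔ (G.rk N : ℤ) = d + 1 := by
  have key : G.HasDim N ((G.rk N : ℤ) - 1) := by
    obtain ⟨X, hX, hc⟩ := (hG.hasChainRank_rk hN).exists_spanning
    refine ⟨⟨X, hX, by rw [hc]⟩, ?_⟩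
    rintro _ ⟨Y, hY, rfl⟩
    have hs : (Y : Set P) ⊆ N := hY ▸ subset_span _
    have := hG.rk_span_le Y ((hG.perp_self hN).mono hs hs)
    rw [hY] at this
    omega
  constructor
  · intro h
    have := h.unique key
    omega
  · intro h
    rwa [show d = (G.rk N : ℤ) - 1 by omega]

theorem mem_grassmannian (hG : G.IsPerpSpace) {N : Set P} {d : ℤ} :
    N ∈ G.grassmannian d ↔ G.IsSingular N ∧ (G.rk N : ℤ) = d + 1 :=
  and_congr_right fun h => hG.hasDim_iff h

end IsPerpSpace
-- Hyperplanes and codimension counts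
/-- The points collinear to all points of `A`. -/
def perp (G : PointLineGeometry P) (A : Set P) : Set P :=
  {x | ∀ a ∈ A, G.Collinear x a}

theorem perp_anti {A B : Set P} (h : A ⊆ B) : G.perp B ⊆ G.perp A :=
  fun _ hx a ha => hx a (h ha)

theorem Perp.subset_perp {A B : Set P} (h : G.Perp A B) : A ⊆ G.perp B := h

namespace IsPerpSpace

theorem isSubspace_perp_set (hG : G.IsPerpSpace) (A : Set P) : G.IsSubspace (G.perp A) := by
  intro p hp q hq hpq L hL hpL hqL x hx a ha
  exact (hG.collinear_line a L hL p hpL q hqL hpq (hp a ha).symm (hq a ha).symm x hx).symm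

theorem isSingular_empty : G.IsSingular ∅ := ⟨isSubspace_empty, fun _ h => h.elim⟩

theorem adjoin_eq_of_rk (hG : G.IsPerpSpace) {H X : Set P} {p : P} (hH : G.IsSingular H)
    (hX : G.IsSingular X) (hHX : H ⊆ X) (hr : G.rk X ≤ G.rk H + 1) (hp : p ∈ X) (hpH : p ∉ H) :
    G.adjoin H p = X := by
  have hpr := hG.mem_residue_of_mem hX hHX hp hpH
  refine hG.eq_of_subset_of_rk_le (hG.isSingular_adjoin hH hpr.2) hX
    (adjoin_subset hX.1 hHX hp) ?_
  rw [hG.rk_adjoin hH hpr]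
  exact hr

theorem exists_mem_notMem (hG : G.IsPerpSpace) {H X : Set P} (hH : G.IsSingular H)
    (hX : G.IsSingular X) (hr : G.rk H < G.rk X) : ∃ p ∈ X, p ∉ H :=
  Set.not_subset.1 fun h => (hG.rk_mono hX hH h).not_gt hr

theorem exists_adjoin_eq (hG : G.IsPerpSpace) {H X : Set P} (hH : G.IsSingular H)
    (hX : G.IsSingular X) (hHX : H ⊆ X) (hr : G.rk X = G.rk H + 1) :
    ∃ p ∈ G.residue H, G.adjoin H p = X := by
  obtain ⟨p, hp, hpH⟩ := hG.exists_mem_notMem hH hX (by omega)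
  exact ⟨p, hG.mem_residue_of_mem hX hHX hp hpH, hG.adjoin_eq_of_rk hH hX hHX hr.le hp hpH⟩

theorem rk_le_rk_inter_hyperplane (hG : G.IsPerpSpace) {H X Y : Set P} (hH : G.IsSingular H)
    (hX : G.IsSingular X) (hHX : H ⊆ X) (hr : G.rk X = G.rk H + 1) (hY : G.IsSingular Y)
    (hYX : Y ⊆ X) : G.rk Y ≤ G.rk (Y ∩ H) + 1 := by
  obtain ⟨p, hp, rfl⟩ := hG.exists_adjoin_eq hH hX hHX hr
  exact hG.rk_le_rk_inter_succ hY hH.1 fun L hL h => hG.line_meets hH hp hL (h.trans hYX)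

theorem rk_le_rk_inter_perp (hG : G.IsPerpSpace) {Y : Set P} (hY : G.IsSingular Y) (p : P) :
    G.rk Y ≤ G.rk (Y ∩ {x | G.Collinear p x}) + 1 :=
  hG.rk_le_rk_inter_succ hY (hG.isSubspace_perp p) fun L hL _ => hG.exists_collinear p L hL

/-- A point x of ⟨N, p⟩ outside N spans it together with N, so z would be collinear to p. -/
theorem mem_of_mem_adjoin_of_collinear (hG : G.IsPerpSpace) {N : Set P} {p x z : P}
    (hN : G.IsSingular N) (hp : p ∈ G.residue N) (hzN : ∀ y ∈ N, G.Collinear z y)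
    (hzp : ¬ G.Collinear z p) (hx : x ∈ G.adjoin N p) (hzx : G.Collinear z x) : x ∈ N := by
  by_contra hxN
  have := hG.adjoin_eq_of_mem hN hp hx hxN
  exact hzp (hG.perp_adjoin hzN hzx p (this ▸ mem_adjoin N p))

theorem exists_hyperplane (hG : G.IsPerpSpace) {Q Y : Set P} (hQ : G.IsSingular Q)
    (hY : G.IsSingular Y) (hQY : Q ⊆ Y) (hr : G.rk Q < G.rk Y) :
    ∃ H, G.IsSingular H ∧ Q ⊆ H ∧ H ⊆ Y ∧ G.rk H + 1 = G.rk Y := by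
  obtain ⟨H, ⟨hH, hHY, hne⟩, hQH, hmax⟩ := hG.exists_maximal
    (fun S => G.IsSingular S ∧ S ⊆ Y ∧ S ≠ Y) (fun S hS => hS.1) (A := Q)
    ⟨hQ, hQY, fun h => by rw [h] at hr; omega⟩
  obtain ⟨p, hp, hpH⟩ := Set.exists_of_ssubset (hHY.ssubset_of_ne hne)
  have hpr := hG.mem_residue_of_mem hY hHY hp hpH
  have h1 : G.adjoin H p = Y := by
    by_contra h
    have := hmax (G.adjoin H p) ⟨hG.isSingular_adjoin hH hpr.2, adjoin_subset hY.1 hHY hp, h⟩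
      (subset_adjoin H p)
    exact hpH (this ▸ mem_adjoin H p)
  exact ⟨H, hH, hQH, hHY, by rw [← h1, hG.rk_adjoin hH hpr]⟩

/-- The perp of `Y` cuts a singular subspace in codimension at most `d` if `Y` is spanned by `d`
points and a part whose perp contains the singular subspace. -/
theorem rk_le_rk_inter_perp_add (hG : G.IsPerpSpace) {W Q : Set P} (hW : G.IsSingular W)
    (hQ : G.IsSingular Q) (hWQ : G.Perp W Q) (d : ℕ) : ∀ {Y : Set P}, G.IsSingular Y → Q ⊆ Y →
      G.rk Y = G.rk Q + d → G.rk W ≤ G.rk (W ∩ G.perp Y) + d := by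
  induction d with
  | zero =>
    intro Y hY hQY hr
    obtain rfl := hG.eq_of_subset_of_rk_le hQ hY hQY hr.le
    rw [Set.inter_eq_left.2 hWQ.subset_perp]
    rfl
  | succ d ih =>
    intro Y hY hQY hr
    obtain ⟨H, hH, hQH, hHY, hrH⟩ := hG.exists_hyperplane hQ hY hQY (by omega)
    obtain ⟨p, hp, rfl⟩ := hG.exists_adjoin_eq hH hY hHY hrH.symm
    have h1 := ih hH hQH (by omega)
    have h2 := hG.rk_le_rk_inter_perp (hW.inter (hG.isSubspace_perp_set H)) p
    have h3 : W ∩ G.perp H ∩ {x | G.Collinear p x} ⊆ W ∩ G.perp (G.adjoin H p) := by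
      rintro x ⟨⟨hxW, hxH⟩, hxp⟩
      exact ⟨hxW, hG.perp_adjoin hxH hxp.symm⟩
    have h4 := hG.rk_mono ((hW.inter (hG.isSubspace_perp_set H)).inter (hG.isSubspace_perp p))
      (hW.inter (hG.isSubspace_perp_set _)) h3
    omega

theorem exists_maximal_singular (hG : G.IsPerpSpace) {X : Set P} (hX : G.IsSingular X) :
    ∃ M, X ⊆ M ∧ Maximal G.IsSingular M := by
  obtain ⟨M, hM, hXM, hmax⟩ := hG.exists_maximal G.IsSingular (fun _ h => h) hX
  exact ⟨M, hXM, hM, fun B hB hMB => (hmax B hB hMB).subset⟩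

theorem exists_maximal_rk (hG : G.IsPerpSpace) {n : ℕ} (hn : G.HasRank n) {X : Set P}
    (hX : G.IsSingular X) : ∃ M, X ⊆ M ∧ G.IsSingular M ∧ G.rk M = n := by
  obtain ⟨M, hXM, hM⟩ := hG.exists_maximal_singular hX
  have := (hG.hasDim_iff hM.1).1 (hn M hM)
  exact ⟨M, hXM, hM.1, by omega⟩

theorem rk_le (hG : G.IsPerpSpace) {n : ℕ} (hn : G.HasRank n) {X : Set P}
    (hX : G.IsSingular X) : G.rk X ≤ n := by
  obtain ⟨M, hXM, hM, rfl⟩ := hG.exists_maximal_rk hn hX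
  exact hG.rk_mono hX hM hXM

theorem exists_mem_residue (hG : G.IsPerpSpace) {n : ℕ} (hn : G.HasRank n) {X : Set P}
    (hX : G.IsSingular X) (hr : G.rk X < n) : ∃ p, p ∈ G.residue X := by
  obtain ⟨M, hXM, hM, rfl⟩ := hG.exists_maximal_rk hn hX
  obtain ⟨p, hp, hpX⟩ := hG.exists_mem_notMem hX hM hr
  exact ⟨p, hG.mem_residue_of_mem hM hXM hp hpX⟩

/-! ### Connectedness of residues -/

theorem notMem_adjoin_comm (hG : G.IsPerpSpace) {N : Set P} {p q : P} (hN : G.IsSingular N)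
    (hp : p ∈ G.residue N) (hq : q ∈ G.residue N) (h : q ∉ G.adjoin N p) :
    p ∉ G.adjoin N q := fun h' =>
  h (hG.adjoin_eq_of_mem hN hq h' hp.1 ▸ mem_adjoin N q)

theorem mem_residue_adjoin (hG : G.IsPerpSpace) {N : Set P} {p q : P}
    (hq : q ∈ G.residue N) (hpq : G.Collinear q p) (h : q ∉ G.adjoin N p) :
    q ∈ G.residue (G.adjoin N p) :=
  ⟨h, hG.perp_adjoin hq.2 hpq⟩

theorem mem_residue_of_mem_residue_adjoin {N : Set P} {p q : P}
    (hq : q ∈ G.residue (G.adjoin N p)) : q ∈ G.residue N :=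
  ⟨fun h => hq.1 (subset_adjoin N p h), fun x hx => hq.2 x (subset_adjoin N p hx)⟩

/-- The rank bound leaves a point u outside ⟨N, d⟩ collinear to all of it; e is the point of the
line ud collinear to c. -/
theorem exists_common_neighbor (hG : G.IsPerpSpace) {n : ℕ} (hn : G.HasRank n) {N : Set P}
    (hN : G.IsSingular N) (hr : G.rk N + 2 ≤ n) {c d : P} (hc : c ∈ G.residue N)
    (hd : d ∈ G.residue N) (hcd : ¬ G.Collinear c d) :
    ∃ e ∈ G.residue N, G.Collinear e c ∧ G.Collinear e d ∧ e ∉ G.adjoin N c ∧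
      e ∉ G.adjoin N d := by
  have hNd := hG.isSingular_adjoin hN hd.2
  obtain ⟨u, hu⟩ := hG.exists_mem_residue hn hNd (by rw [hG.rk_adjoin hN hd]; omega)
  have hud : u ≠ d := by
    rintro rfl
    exact hu.1 (mem_adjoin N _)
  obtain ⟨L, hL, huL, hdL⟩ := hu.2 d (mem_adjoin N d)
  obtain ⟨e, heL, hce⟩ := hG.exists_collinear c L hL
  have hed : e ≠ d := by
    rintro rfl
    exact hcd hce
  have heNd : e ∉ G.adjoin N d := fun h => hu.1
    (hNd.1 e h d (mem_adjoin N d) hed L hL heL hdL huL)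
  have heN : e ∈ G.residue N := by
    refine ⟨fun h => heNd (subset_adjoin N d h), fun x hx => ?_⟩
    exact (hG.collinear_line x L hL u huL d hdL hud
      (hu.2 x (subset_adjoin N d hx)).symm (hd.2 x hx).symm e heL).symm
  have hedc : G.Collinear e d := ⟨L, hL, heL, hdL⟩
  refine ⟨e, heN, hce.symm, hedc, fun h => hcd ?_, heNd⟩
  exact (hG.perp_adjoin hd.2 hedc.symm c
    (hG.adjoin_eq_of_mem hN hc h heN.1 ▸ mem_adjoin N c)).symm

/-- The residue of a singular subspace of corank at least two is connected. -/
theorem residue_induction (hG : G.IsPerpSpace) {n : ℕ} (hn : G.HasRank n) {N : Set P}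
    (hN : G.IsSingular N) (hr : G.rk N + 2 ≤ n) {T : P → Prop}
    (step : ∀ c ∈ G.residue N, ∀ d ∈ G.residue N, G.Collinear c d → d ∉ G.adjoin N c →
      T c → T d) {c d : P} (hc : c ∈ G.residue N) (hd : d ∈ G.residue N) (h : T c) : T d := by
  by_cases hcd : G.Collinear c d
  · by_cases hdc : d ∈ G.adjoin N c
    · have hNc := hG.isSingular_adjoin hN hc.2
      obtain ⟨e, he⟩ := hG.exists_mem_residue hn hNc (by rw [hG.rk_adjoin hN hc]; omega)
      have heN := mem_residue_of_mem_residue_adjoin he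
      refine step e heN d hd (he.2 d hdc) ?_
        (step c hc e heN (he.2 c (mem_adjoin N c)).symm he.1 h)
      refine hG.notMem_adjoin_comm hN hd heN ?_
      rw [hG.adjoin_eq_of_mem hN hc hdc hd.1]
      exact he.1
    · exact step c hc d hd hcd hdc h
  · obtain ⟨e, he, hec, hed, hec', hed'⟩ := hG.exists_common_neighbor hn hN hr hc hd hcd
    exact step e he d hd hed (hG.notMem_adjoin_comm hN hd he hed') (step c hc e he hec.symm hec' h)

end IsPerpSpace

/-! ### Opposite singular subspaces -/

/-- `X` and `Y` are opposite in the residue of their common subspace `Q`. -/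
structure OppositeOver (G : PointLineGeometry P) (Q X Y : Set P) : Prop where
  left : G.IsSingular X
  right : G.IsSingular Y
  subset_left : Q ⊆ X
  subset_right : Q ⊆ Y
  inter_perp_left : X ∩ G.perp Y ⊆ Q
  inter_perp_right : Y ∩ G.perp X ⊆ Q

theorem OppositeOver.symm {Q X Y : Set P} (h : G.OppositeOver Q X Y) : G.OppositeOver Q Y X :=
  ⟨h.right, h.left, h.subset_right, h.subset_left, h.inter_perp_right, h.inter_perp_left⟩

namespace IsPerpSpace

theorem inter_eq_of_oppositeOver (hG : G.IsPerpSpace) {Q X Y : Set P}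
    (h : G.OppositeOver Q X Y) : X ∩ Y = Q :=
  Set.Subset.antisymm (fun x hx => h.inter_perp_left ⟨hx.1, fun y hy =>
    hG.perp_self h.right x hx.2 y hy⟩) (Set.subset_inter h.subset_left h.subset_right)

/-- Since ⟨X, p⟩ has rank rk Y + 1 and the perp of Y costs at most rk Y − rk Q, the part of ⟨X, p⟩
perpendicular to Y has rank above rk Q. By opposition X contains no such point outside Q. -/
theorem exists_adjoin_perp (hG : G.IsPerpSpace) {Q X Y : Set P} {p : P} (hQ : G.IsSingular Q)
    (h : G.OppositeOver Q X Y) (hr : G.rk X = G.rk Y) (hp : p ∈ G.residue X) :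
    ∃ x ∈ G.adjoin X p, x ∉ X ∧ x ∈ G.perp Y := by
  have hW := hG.isSingular_adjoin h.left hp.2
  have hQX : Q ⊆ G.adjoin X p := h.subset_left.trans (subset_adjoin X p)
  have hQr := hG.rk_mono hQ h.right h.subset_right
  have h1 := hG.rk_le_rk_inter_perp_add hW hQ ((hG.perp_self hW).mono subset_rfl hQX)
    (G.rk Y - G.rk Q) h.right h.subset_right (by omega)
  rw [hG.rk_adjoin h.left hp] at h1
  obtain ⟨x, hx, hxQ⟩ := hG.exists_mem_notMem hQ (hW.inter (hG.isSubspace_perp_set Y))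
    (by omega)
  exact ⟨x, hx.1, fun hxX => hxQ (h.inter_perp_left ⟨hxX, hx.2⟩), hx.2⟩

theorem inter_perp_adjoin_subset (hG : G.IsPerpSpace) {Q X Y : Set P} {x y : P}
    (h : G.OppositeOver Q X Y) (hx : x ∈ G.residue X) (hy : y ∈ G.perp X)
    (hxy : ¬ G.Collinear y x) : G.adjoin X x ∩ G.perp (G.adjoin Y y) ⊆ Q := by
  rintro v ⟨hv, hv'⟩
  refine h.inter_perp_left ⟨?_, perp_anti (subset_adjoin Y y) hv'⟩
  exact hG.mem_of_mem_adjoin_of_collinear h.left hx hy hxy hv (hv' y (mem_adjoin Y y)).symm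

/-- The new points x ⊥ Y and y ⊥ X are chosen noncollinear. Then the perp of y cuts ⟨X, x⟩ down to X
and the perp of Y cuts X down to Q, and likewise on the other side. -/
theorem exists_oppositeOver_succ (hG : G.IsPerpSpace) {n : ℕ} (hn : G.HasRank n) {Q X Y : Set P}
    (hQ : G.IsSingular Q) (h : G.OppositeOver Q X Y) (hr : G.rk X = G.rk Y) (hX : G.rk X < n) :
    ∃ X' Y', G.OppositeOver Q X' Y' ∧ X ⊆ X' ∧ Y ⊆ Y' ∧ G.rk X' = G.rk X + 1 ∧
      G.rk Y' = G.rk Y + 1 := by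
  obtain ⟨p, hp⟩ := hG.exists_mem_residue hn h.left hX
  obtain ⟨x, hxp, hxX, hxY⟩ := hG.exists_adjoin_perp hQ h hr hp
  have hxr : x ∈ G.residue X := hG.mem_residue_of_mem (hG.isSingular_adjoin h.left hp.2)
    (subset_adjoin X p) hxp hxX
  have hxrY : x ∈ G.residue Y :=
    ⟨fun hx => hxX (h.subset_left (h.inter_perp_right ⟨hx, hxr.2⟩)), hxY⟩
  obtain ⟨q, hqY, hqx, _⟩ := hG.separation h.right hxrY
  have hq : q ∈ G.residue Y := ⟨fun hqY => hqx (hxY q hqY).symm, hqY⟩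
  obtain ⟨y, hyq, hyY, hyX⟩ := hG.exists_adjoin_perp hQ h.symm hr.symm hq
  have hyr : y ∈ G.residue Y := hG.mem_residue_of_mem (hG.isSingular_adjoin h.right hq.2)
    (subset_adjoin Y q) hyq hyY
  have hxy : ¬ G.Collinear x y := fun hxy =>
    hyY (hG.mem_of_mem_adjoin_of_collinear h.right hq hxY (fun h => hqx h.symm) hyq hxy)
  refine ⟨G.adjoin X x, G.adjoin Y y, ⟨hG.isSingular_adjoin h.left hxr.2,
    hG.isSingular_adjoin h.right hyr.2, h.subset_left.trans (subset_adjoin X x),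
    h.subset_right.trans (subset_adjoin Y y),
    hG.inter_perp_adjoin_subset h hxr hyX fun h => hxy h.symm,
    hG.inter_perp_adjoin_subset h.symm hyr hxY hxy⟩, subset_adjoin X x, subset_adjoin Y y,
    hG.rk_adjoin h.left hxr, hG.rk_adjoin h.right hyr⟩

theorem exists_oppositeOver_rk (hG : G.IsPerpSpace) {n : ℕ} (hn : G.HasRank n) {Q : Set P}
    (hQ : G.IsSingular Q) (d : ℕ) : ∀ {X Y : Set P}, G.OppositeOver Q X Y → G.rk X = G.rk Y →
      G.rk X + d ≤ n → ∃ X' Y', G.OppositeOver Q X' Y' ∧ X ⊆ X' ∧ Y ⊆ Y' ∧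
        G.rk X' = G.rk X + d ∧ G.rk Y' = G.rk Y + d := by
  induction d with
  | zero => exact fun {X Y} h _ _ => ⟨X, Y, h, subset_rfl, subset_rfl, rfl, rfl⟩
  | succ d ih =>
    intro X Y h hr hle
    obtain ⟨X₁, Y₁, h₁, hX₁, hY₁, rX₁, rY₁⟩ := hG.exists_oppositeOver_succ hn hQ h hr (by omega)
    obtain ⟨X₂, Y₂, h₂, hX₂, hY₂, rX₂, rY₂⟩ := ih h₁ (by omega) (by omega)
    exact ⟨X₂, Y₂, h₂, hX₁.trans hX₂, hY₁.trans hY₂, by omega, by omega⟩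

/-- Distinct singular subspaces of equal rank that share a hyperplane `Q` lie in singular
subspaces of any larger rank that are opposite over `Q`. -/
theorem exists_oppositeOver (hG : G.IsPerpSpace) {n K : ℕ} (hn : G.HasRank n) {Q : Set P}
    {r t : P} (hQ : G.IsSingular Q) (hr : r ∈ G.residue Q) (ht : t ∈ G.residue Q)
    (hrt : t ∉ G.adjoin Q r) (hK : G.rk Q + 2 ≤ K) (hKn : K ≤ n) :
    ∃ X Y, G.OppositeOver Q X Y ∧ G.adjoin Q r ⊆ X ∧ G.adjoin Q t ⊆ Y ∧ G.rk X = K ∧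
      G.rk Y = K := by
  have hR := hG.isSingular_adjoin hQ hr.2
  have hT := hG.isSingular_adjoin hQ ht.2
  have rR := hG.rk_adjoin hQ hr
  have rT := hG.rk_adjoin hQ ht
  -- Noncollinear r and t already give opposite subspaces. If they are collinear, each side first
  -- receives a point that is collinear to its own side but not to the generator of the other; this
  -- second added point is why K must be at least rk Q + 2.
  by_cases hc : G.Collinear t r
  · have htr := hG.mem_residue_adjoin ht hc hrt
    have hrr := hG.mem_residue_adjoin hr hc.symm (hG.notMem_adjoin_comm hQ hr ht hrt)
    obtain ⟨x, hxR, hxt, _⟩ := hG.separation hR htr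
    obtain ⟨y, hyT, hyr, _⟩ := hG.separation hT hrr
    have hx : x ∈ G.residue (G.adjoin Q r) := ⟨fun h => hxt (htr.2 x h).symm, hxR⟩
    have hy : y ∈ G.residue (G.adjoin Q t) := ⟨fun h => hyr (hrr.2 y h).symm, hyT⟩
    have hopp : G.OppositeOver Q (G.adjoin (G.adjoin Q r) x) (G.adjoin (G.adjoin Q t) y) := by
      refine ⟨hG.isSingular_adjoin hR hxR, hG.isSingular_adjoin hT hyT,
        (subset_adjoin Q r).trans (subset_adjoin _ x),
        (subset_adjoin Q t).trans (subset_adjoin _ y), ?_, ?_⟩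
      · rintro v ⟨hv, hv'⟩
        have h1 := hG.mem_of_mem_adjoin_of_collinear hR hx htr.2 (fun h => hxt h.symm) hv
          (hv' t (subset_adjoin _ y (mem_adjoin Q t))).symm
        exact hG.mem_of_mem_adjoin_of_collinear hQ hr
          (fun z hz => hyT z (subset_adjoin Q t hz)) hyr h1 (hv' y (mem_adjoin _ y)).symm
      · rintro v ⟨hv, hv'⟩
        have h1 := hG.mem_of_mem_adjoin_of_collinear hT hy hrr.2 (fun h => hyr h.symm) hv
          (hv' r (subset_adjoin _ x (mem_adjoin Q r))).symm
        exact hG.mem_of_mem_adjoin_of_collinear hQ ht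
          (fun z hz => hxR z (subset_adjoin Q r hz)) hxt h1 (hv' x (mem_adjoin _ x)).symm
    have rX := hG.rk_adjoin hR hx
    have rY := hG.rk_adjoin hT hy
    obtain ⟨X, Y, h, hX, hY, h1, h2⟩ := hG.exists_oppositeOver_rk hn hQ (K - (G.rk Q + 2)) hopp
      (by omega) (by omega)
    exact ⟨X, Y, h, (subset_adjoin _ x).trans hX, (subset_adjoin _ y).trans hY, by omega,
      by omega⟩
  · have hopp : G.OppositeOver Q (G.adjoin Q r) (G.adjoin Q t) := by
      refine ⟨hR, hT, subset_adjoin Q r, subset_adjoin Q t, ?_, ?_⟩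
      · rintro v ⟨hv, hv'⟩
        exact hG.mem_of_mem_adjoin_of_collinear hQ hr ht.2 hc hv (hv' t (mem_adjoin Q t)).symm
      · rintro v ⟨hv, hv'⟩
        exact hG.mem_of_mem_adjoin_of_collinear hQ ht hr.2 (fun h => hc h.symm) hv
          (hv' r (mem_adjoin Q r)).symm
    obtain ⟨X, Y, h, hX, hY, h1, h2⟩ := hG.exists_oppositeOver_rk hn hQ (K - (G.rk Q + 1)) hopp
      (by omega) (by omega)
    exact ⟨X, Y, h, hX, hY, by omega, by omega⟩

end IsPerpSpace
-- Adjacency and distance in Grassmann graphs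
/-- Distinct mutually perpendicular subspaces meeting in a hyperplane. -/
def Neighbors (G : PointLineGeometry P) (X Y : Set P) : Prop :=
  X ≠ Y ∧ G.Perp X Y ∧ G.rk X ≤ G.rk (X ∩ Y) + 1

theorem Neighbors.symm {X Y : Set P} (h : G.Neighbors X Y) (hr : G.rk X = G.rk Y) :
    G.Neighbors Y X :=
  ⟨h.1.symm, h.2.1.symm, by rw [← hr, Set.inter_comm]; exact h.2.2⟩

namespace IsPerpSpace

theorem rk_inter_lt (hG : G.IsPerpSpace) {X Y : Set P} (hX : G.IsSingular X)
    (hY : G.IsSingular Y) (hr : G.rk X = G.rk Y) (hne : X ≠ Y) : G.rk (X ∩ Y) < G.rk X := by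
  by_contra! h
  have h1 := hG.eq_of_subset_of_rk_le (hX.inter hY.1) hX Set.inter_subset_left h
  exact hne (hG.eq_of_subset_of_rk_le hX hY (Set.inter_eq_left.1 h1) hr.ge)

theorem rk_inter_of_neighbors (hG : G.IsPerpSpace) {X Y : Set P} (hX : G.IsSingular X)
    (hY : G.IsSingular Y) (hr : G.rk X = G.rk Y) (h : G.Neighbors X Y) :
    G.rk (X ∩ Y) + 1 = G.rk X := by
  have := hG.rk_inter_lt hX hY hr h.1
  have := h.2.2
  omega

theorem neighbors_of_subset (hG : G.IsPerpSpace) {X Y U : Set P} (hX : G.IsSingular X)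
    (hY : G.IsSingular Y) (hU : G.IsSingular U) (hr : G.rk U ≤ G.rk Y + 1) (hne : X ≠ Y)
    (hrXY : G.rk X = G.rk Y) (hXU : X ⊆ U) (hYU : Y ⊆ U) : G.Neighbors X Y := by
  refine ⟨hne, (hG.perp_self hU).mono hXU hYU, ?_⟩
  by_cases h : G.rk U = G.rk Y + 1
  · exact hG.rk_le_rk_inter_hyperplane hY hU hYU h hX hXU
  · have h1 := hG.eq_of_subset_of_rk_le hY hU hYU (by omega)
    have h2 := hG.eq_of_subset_of_rk_le hX hU hXU (by omega)
    exact absurd (h2.trans h1.symm) hne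

theorem adjoin_inter_eq_of_neighbors (hG : G.IsPerpSpace) {X Y : Set P} (hX : G.IsSingular X)
    (hY : G.IsSingular Y) (hr : G.rk X = G.rk Y) (h : G.Neighbors X Y) {y : P} (hy : y ∈ Y)
    (hyX : y ∉ X) : G.adjoin (X ∩ Y) y = Y :=
  hG.adjoin_eq_of_rk (hX.inter hY.1) hY Set.inter_subset_right (hr ▸ h.2.2) hy fun h => hyX h.1

/-- Neighbors span a singular subspace of the next rank. -/
theorem exists_join (hG : G.IsPerpSpace) {X Y : Set P} (hX : G.IsSingular X)
    (hY : G.IsSingular Y) (hr : G.rk X = G.rk Y) (h : G.Neighbors X Y) :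
    ∃ U, G.IsSingular U ∧ G.rk U = G.rk X + 1 ∧ X ⊆ U ∧ Y ⊆ U ∧
      ∀ T, G.IsSubspace T → X ⊆ T → Y ⊆ T → U ⊆ T := by
  obtain ⟨y, hy, hyX⟩ := Set.not_subset.1 fun hs : Y ⊆ X =>
    h.1 (hG.eq_of_subset_of_rk_le hY hX hs hr.le).symm
  have hyr : y ∈ G.residue X := ⟨hyX, fun x hx => (h.2.1 x hx y hy).symm⟩
  refine ⟨G.adjoin X y, hG.isSingular_adjoin hX hyr.2, hG.rk_adjoin hX hyr, subset_adjoin X y, ?_,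
    fun T hT hXT hYT => adjoin_subset hT hXT (hYT hy)⟩
  conv_lhs => rw [← hG.adjoin_inter_eq_of_neighbors hX hY hr h hy hyX]
  exact adjoin_subset (isSubspace_adjoin X y) (Set.inter_subset_left.trans (subset_adjoin X y))
    (mem_adjoin X y)

theorem rk_vertex (hG : G.IsPerpSpace) {k : ℕ} (X : G.grassmannian k) : G.rk X.1 = k + 1 := by
  have := (hG.mem_grassmannian.1 X.2).2
  omega

theorem adj_iff (hG : G.IsPerpSpace) {n k : ℕ} (hk : k + 2 ≤ n) (X Y : G.grassmannian k) :
    (G.grassmannGraph n k).Adj X Y ↔ G.Neighbors X.1 Y.1 := by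
  have rX := hG.rk_vertex X
  have rY := hG.rk_vertex Y
  constructor
  · rintro ⟨hne, ⟨_, U, hU, hXU, hYU⟩ | ⟨h, _⟩⟩
    · obtain ⟨sU, rU⟩ := hG.mem_grassmannian.1 hU
      exact hG.neighbors_of_subset X.2.1 Y.2.1 sU (by omega)
        (fun h => hne (Subtype.ext h)) (by omega) hXU hYU
    · omega
  · intro h
    obtain ⟨U, hU, rU, hXU, hYU, _⟩ := hG.exists_join X.2.1 Y.2.1 (by omega) h
    exact ⟨fun e => h.1 (congrArg _ e), Or.inl ⟨by omega, U,
      hG.mem_grassmannian.2 ⟨hU, by omega⟩, hXU, hYU⟩⟩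

theorem edist_le_one_of_neighbors (hG : G.IsPerpSpace) {n k : ℕ} (hk : k + 2 ≤ n)
    {X Y : G.grassmannian k} (h : G.Neighbors X.1 Y.1) :
    (G.grassmannGraph n k).edist X Y ≤ 1 :=
  (SimpleGraph.edist_eq_one_iff_adj.2 ((hG.adj_iff hk X Y).2 h)).le

theorem neighbors_adjoin (hG : G.IsPerpSpace) {H X : Set P} {q : P} (hH : G.IsSingular H)
    (hX : G.IsSingular X) (hHX : H ⊆ X) (hr : G.rk X = G.rk H + 1) (hq : q ∈ G.residue X) :
    G.Neighbors X (G.adjoin H q) := by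
  have hqH : ∀ x ∈ H, G.Collinear q x := fun x hx => hq.2 x (hHX hx)
  refine ⟨fun h => hq.1 (h ▸ mem_adjoin H q), fun x hx => ?_, ?_⟩
  · exact hG.perp_adjoin (fun y hy => hG.perp_self hX x hx y (hHX hy)) (hq.2 x hx).symm
  · rw [hr]
    exact Nat.succ_le_succ (hG.rk_mono hH (hX.inter (isSubspace_adjoin H q))
      (Set.subset_inter hHX (subset_adjoin H q)))

/-- The point q of Y is exchanged for a point of X, so that the intersection with Y gains one rank
in one step. The care is in keeping a suitable hyperplane H of X, so that the new vertex again
admits a point of Y perpendicular to it. -/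
theorem edist_le_of_mem_perp (hG : G.IsPerpSpace) {n k : ℕ} (hk : k + 2 ≤ n) (e : ℕ) :
    ∀ {X Y : G.grassmannian k}, k + 1 = G.rk (X.1 ∩ Y.1) + e →
      (∃ q ∈ Y.1, q ∈ G.residue X.1) → (G.grassmannGraph n k).edist X Y ≤ e := by
  induction e with
  | zero =>
    rintro X Y he ⟨q, hqY, hqX⟩
    have := hG.eq_of_subset_of_rk_le (X.2.1.inter Y.2.1.1) Y.2.1 Set.inter_subset_right
      (by rw [hG.rk_vertex Y]; omega)
    exact absurd (Set.inter_eq_right.1 this hqY) hqX.1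
  | succ e ih =>
    rintro X Y he ⟨q, hqY, hqX⟩
    have sX := X.2.1
    have sY := Y.2.1
    have rX := hG.rk_vertex X
    have rY := hG.rk_vertex Y
    have sI := sX.inter sY.1
    have hqI : q ∈ G.residue (X.1 ∩ Y.1) := ⟨fun h => hqX.1 h.1, fun x hx => hqX.2 x hx.1⟩
    have sQ := hG.isSingular_adjoin sI hqI.2
    have rQ := hG.rk_adjoin sI hqI
    have hQY : G.adjoin (X.1 ∩ Y.1) q ⊆ Y.1 := adjoin_subset sY.1 Set.inter_subset_right hqY
    rcases Nat.eq_zero_or_pos e with rfl | he0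
    · have hYeq : G.adjoin (X.1 ∩ Y.1) q = Y.1 :=
        hG.eq_of_subset_of_rk_le sQ sY hQY (by omega)
      refine le_trans (hG.edist_le_one_of_neighbors hk ?_) (by simp)
      rw [← hYeq]
      exact hG.neighbors_adjoin sI sX Set.inter_subset_left (by omega) hqX
    -- The subspace ⟨X ∩ Y, q⟩ of Y is perpendicular to X and has codimension e in Y, so the points
    -- of X perpendicular to Y form a subspace larger than X ∩ Y.
    have h1 := hG.rk_le_rk_inter_perp_add sX sQ (fun x hx => hG.perp_adjoin
      (fun y hy => hG.perp_self sX x hx y hy.1) (hqX.2 x hx).symm) e sY hQY (by omega)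
    obtain ⟨p, hp, hpI⟩ := hG.exists_mem_notMem sI (sX.inter (hG.isSubspace_perp_set Y.1))
      (by omega)
    have hpr : p ∈ G.residue (X.1 ∩ Y.1) := hG.mem_residue_of_mem sX Set.inter_subset_left hp.1 hpI
    have sp := hG.isSingular_adjoin sI hpr.2
    have rp := hG.rk_adjoin sI hpr
    obtain ⟨H, sH, hpH, hHX, rH⟩ := hG.exists_hyperplane sp sX
      (adjoin_subset sX.1 Set.inter_subset_left hp.1) (by omega)
    have hIH := (subset_adjoin (G := G) (X.1 ∩ Y.1) p).trans hpH
    have hqH : q ∈ G.residue H := ⟨fun h => hqX.1 (hHX h), fun x hx => hqX.2 x (hHX hx)⟩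
    have sX₁ := hG.isSingular_adjoin sH hqH.2
    have rX₁ := hG.rk_adjoin sH hqH
    let X₁ : G.grassmannian k := ⟨G.adjoin H q, hG.mem_grassmannian.2 ⟨sX₁, by omega⟩⟩
    have hadj : G.Neighbors X.1 X₁.1 := hG.neighbors_adjoin sH sX hHX (by omega) hqX
    have sI₁ := sX₁.inter sY.1
    have h2 := hG.rk_mono sQ sI₁ (Set.subset_inter (adjoin_subset sX₁.1
      (hIH.trans (subset_adjoin H q)) (mem_adjoin H q)) hQY)
    have h3 := hG.rk_le_rk_inter_hyperplane sH sX₁ (subset_adjoin H q) rX₁ sI₁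
      Set.inter_subset_left
    have h4 := hG.rk_mono (sI₁.inter sH.1) sI fun x hx => ⟨hHX hx.2, hx.1.2⟩
    -- As H contains X ∩ Y and p, all perpendicular to Y, only e − 1 further generators of H cut Y
    -- down. What remains has rank at least rk (X ∩ Y) + 2, more than X₁ ∩ Y, and yields the next
    -- point to exchange.
    have h5 := hG.rk_le_rk_inter_perp_add sY sp (fun y hy => hG.perp_adjoin
      (fun x hx => hG.perp_self sY y hy x hx.2) (hp.2 y hy).symm) (e - 1) sH hpH (by omega)
    obtain ⟨q₁, hq₁, hq₁'⟩ := hG.exists_mem_notMem sI₁ (sY.inter (hG.isSubspace_perp_set H))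
      (by omega)
    have hq₁X : q₁ ∈ G.residue X₁.1 :=
      ⟨fun h => hq₁' ⟨h, hq₁.1⟩, hG.perp_adjoin hq₁.2 (hG.perp_self sY q₁ hq₁.1 q hqY)⟩
    have hd := ih (X := X₁) (Y := Y) (show k + 1 = G.rk (G.adjoin H q ∩ Y.1) + e by omega)
      ⟨q₁, hq₁.1, hq₁X⟩
    calc (G.grassmannGraph n k).edist X Y
        ≤ (G.grassmannGraph n k).edist X X₁ + (G.grassmannGraph n k).edist X₁ Y :=
          SimpleGraph.edist_triangle
      _ ≤ 1 + e := add_le_add (hG.edist_le_one_of_neighbors hk hadj) hd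
      _ = ((e + 1 : ℕ) : ℕ∞) := by push_cast; ring

/-- The extra 1 pays for a preliminary step when the chosen y ∈ Y is not perpendicular to X. With H
the part of X collinear to y, a point z collinear to X and y replaces X by ⟨H, z⟩. This keeps X ∩ Y,
which lies in H, and makes y perpendicular to the new vertex. -/
theorem edist_le (hG : G.IsPerpSpace) {n k : ℕ} (hn : G.HasRank n) (hk : k + 2 ≤ n)
    {X Y : G.grassmannian k} {e : ℕ} (he : k + 1 ≤ G.rk (X.1 ∩ Y.1) + e) :
    (G.grassmannGraph n k).edist X Y ≤ (e + 1 : ℕ) := by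
  have sX := X.2.1
  have sY := Y.2.1
  have rX := hG.rk_vertex X
  have rY := hG.rk_vertex Y
  have sI := sX.inter sY.1
  have hle := hG.rk_mono sI sX Set.inter_subset_left
  by_cases hYX : Y.1 ⊆ X.1
  · rw [Subtype.ext (hG.eq_of_subset_of_rk_le sY sX hYX (by omega)), SimpleGraph.edist_self]
    exact zero_le
  obtain ⟨y, hy, hyX⟩ := Set.not_subset.1 hYX
  by_cases hperp : ∀ x ∈ X.1, G.Collinear y x
  · refine (hG.edist_le_of_mem_perp hk (k + 1 - G.rk (X.1 ∩ Y.1)) (by omega)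
      ⟨y, hy, hyX, hperp⟩).trans ?_
    exact_mod_cast (by omega : k + 1 - G.rk (X.1 ∩ Y.1) ≤ e + 1)
  push Not at hperp
  obtain ⟨x, hx, hyx⟩ := hperp
  set H := X.1 ∩ {x | G.Collinear y x}
  have sH : G.IsSingular H := sX.inter (hG.isSubspace_perp y)
  have hHX : H ⊆ X.1 := Set.inter_subset_left
  have hxH : x ∉ H := fun h => hyx h.2
  have hxr := hG.mem_residue_of_mem sX hHX hx hxH
  have h1 := hG.rk_le_rk_inter_perp sX y
  have hXeq : G.adjoin H x = X.1 := hG.adjoin_eq_of_rk sH sX hHX h1 hx hxH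
  have rH := hG.rk_adjoin sH hxr
  rw [hXeq] at rH
  have hyr : y ∈ G.residue H := ⟨fun h => hyX h.1, fun z hz => hz.2⟩
  obtain ⟨z, hz, hzx, hzy, hzX, hzy'⟩ := hG.exists_common_neighbor hn sH (by omega) hxr hyr
    fun h => hyx h.symm
  rw [hXeq] at hzX
  have hzX' : z ∈ G.residue X.1 := ⟨hzX, hXeq ▸ hG.perp_adjoin hz.2 hzx⟩
  have sX₁ := hG.isSingular_adjoin sH hz.2
  let X₁ : G.grassmannian k := ⟨G.adjoin H z, hG.mem_grassmannian.2
    ⟨sX₁, by rw [hG.rk_adjoin sH hz]; omega⟩⟩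
  have hadj : G.Neighbors X.1 X₁.1 := hG.neighbors_adjoin sH sX hHX rH hzX'
  have h2 := hG.rk_mono sI (sX₁.inter sY.1) fun w hw =>
    ⟨subset_adjoin H z ⟨hw.1, hG.perp_self sY y hy w hw.2⟩, hw.2⟩
  have h3 := hG.rk_mono (sX₁.inter sY.1) sY Set.inter_subset_right
  have hd := hG.edist_le_of_mem_perp hk (k + 1 - G.rk (G.adjoin H z ∩ Y.1)) (X := X₁) (Y := Y)
    (show k + 1 = G.rk (G.adjoin H z ∩ Y.1) + _ by omega)
    ⟨y, hy, hG.notMem_adjoin_comm sH hyr hz hzy', hG.perp_adjoin hyr.2 hzy.symm⟩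
  calc (G.grassmannGraph n k).edist X Y
      ≤ (G.grassmannGraph n k).edist X X₁ + (G.grassmannGraph n k).edist X₁ Y :=
        SimpleGraph.edist_triangle
    _ ≤ 1 + ((k + 1 - G.rk (G.adjoin H z ∩ Y.1) : ℕ) : ℕ∞) :=
        add_le_add (hG.edist_le_one_of_neighbors hk hadj) hd
    _ ≤ ((e + 1 : ℕ) : ℕ∞) := by
        exact_mod_cast (by omega : 1 + (k + 1 - G.rk (G.adjoin H z ∩ Y.1)) ≤ e + 1)

/-- Adjacent vertices share a hyperplane, so each step changes the rank of the intersection with Y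
by at most one. -/
theorem le_rk_inter_add_length (hG : G.IsPerpSpace) {n k : ℕ} (hk : k + 2 ≤ n)
    {X Y : G.grassmannian k} (w : (G.grassmannGraph n k).Walk X Y) :
    k + 1 ≤ G.rk (X.1 ∩ Y.1) + w.length := by
  induction w with
  | nil => rw [Set.inter_self, hG.rk_vertex]; exact Nat.le_add_right _ _
  | @cons X X₁ Y h w ih =>
    have h := ((hG.adj_iff hk X X₁).1 h).symm (by rw [hG.rk_vertex, hG.rk_vertex])
    have rX := hG.rk_vertex X₁
    have hr := hG.rk_inter_of_neighbors X₁.2.1 X.2.1 (by rw [hG.rk_vertex, hG.rk_vertex]) h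
    have sI := X₁.2.1.inter X.2.1.1
    have h1 := hG.rk_le_rk_inter_hyperplane sI X₁.2.1 Set.inter_subset_left (by omega)
      (X₁.2.1.inter Y.2.1.1) Set.inter_subset_left
    have h2 := hG.rk_mono ((X₁.2.1.inter Y.2.1.1).inter sI.1) (X.2.1.inter Y.2.1.1)
      fun x hx => ⟨hx.2.2, hx.1.2⟩
    rw [SimpleGraph.Walk.length_cons]
    omega

/-- The first step of a walk is wasted: its end X₁ is perpendicular to X, so X₁ ∩ Y consists of
points of Y perpendicular to X and lies in Q. -/
theorem lt_edist_of_oppositeOver (hG : G.IsPerpSpace) {n k : ℕ} (hk : k + 2 ≤ n)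
    {X Y : G.grassmannian k} {Q : Set P} (h : G.OppositeOver Q X.1 Y.1) (hQ : G.rk Q < k + 1)
    {e : ℕ} (he : G.rk Q + e = k + 1) : (e : ℕ∞) < (G.grassmannGraph n k).edist X Y := by
  by_contra! hle
  have hI := hG.inter_eq_of_oppositeOver h
  obtain ⟨w, hw⟩ := SimpleGraph.exists_walk_of_edist_ne_top
    (ne_top_of_le_ne_top (ENat.natCast_ne_top e) hle)
  rw [← hw] at hle
  have hle : w.length ≤ e := by exact_mod_cast hle
  cases w with
  | nil =>
    rw [Set.inter_self] at hI
    rw [← hI, hG.rk_vertex] at hQ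
    omega
  | @cons _ X₁ _ hadj w =>
    have h1 := hG.le_rk_inter_add_length hk w
    have hadj := (hG.adj_iff hk X X₁).1 hadj
    have h2 := hG.rk_mono (X₁.2.1.inter Y.2.1.1) (X.2.1.inter Y.2.1.1) fun x hx =>
      ⟨h.subset_left (h.inter_perp_right ⟨hx.2, fun y hy => (hadj.2.1 y hy x hx.1).symm⟩), hx.2⟩
    rw [hI] at h2
    rw [SimpleGraph.Walk.length_cons] at hle
    omega

/-! ### Configurations of mutual neighbors -/

theorem span_union_of_neighbors (hG : G.IsPerpSpace) {A B : Set P} (hA : G.IsSingular A)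
    (hB : G.IsSingular B) (hr : G.rk A = G.rk B) (h : G.Neighbors A B) :
    G.IsSingular (G.span (A ∪ B)) ∧ G.rk (G.span (A ∪ B)) = G.rk A + 1 := by
  obtain ⟨U, hU, rU, hAU, hBU, hmin⟩ := hG.exists_join hA hB hr h
  have : G.span (A ∪ B) = U := (span_subset hU.1 (Set.union_subset hAU hBU)).antisymm
    (hmin _ (isSubspace_span _) (Set.subset_union_left.trans (subset_span _))
      (Set.subset_union_right.trans (subset_span _)))
  rw [this]
  exact ⟨hU, rU⟩

theorem eq_span_union (hG : G.IsPerpSpace) {A B X : Set P} (hA : G.IsSingular A)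
    (hB : G.IsSingular B) (hX : G.IsSingular X) (hAX : A ⊆ X) (hBX : B ⊆ X)
    (hr : G.rk A = G.rk B) (hrX : G.rk X = G.rk A + 1) (hAB : A ≠ B) : X = G.span (A ∪ B) := by
  obtain ⟨sU, rU⟩ := hG.span_union_of_neighbors hA hB hr
    (hG.neighbors_of_subset hA hB hX (by omega) hAB hr hAX hBX)
  exact (hG.eq_of_subset_of_rk_le sU hX (span_subset hX.1 (Set.union_subset hAX hBX))
    (by omega)).symm

/-- Three mutual neighbors share a hyperplane or lie in a common subspace of the next rank. -/
theorem inter_subset_or_subset_span (hG : G.IsPerpSpace) {A B C : Set P} (hA : G.IsSingular A)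
    (hB : G.IsSingular B) (hC : G.IsSingular C) (hrB : G.rk A = G.rk B) (hrC : G.rk A = G.rk C)
    (hAB : G.Neighbors A B) (hAC : G.Neighbors A C) (hBC : G.Neighbors B C) :
    A ∩ B ⊆ C ∨ C ⊆ G.span (A ∪ B) := by
  by_cases h : A ∩ C ⊆ B
  · left
    have h1 : A ∩ C ⊆ A ∩ B := Set.subset_inter Set.inter_subset_left h
    have r1 := hG.rk_inter_of_neighbors hA hB hrB hAB
    have r2 := hG.rk_inter_of_neighbors hA hC hrC hAC
    rw [← hG.eq_of_subset_of_rk_le (hA.inter hC.1) (hA.inter hB.1) h1 (by omega)]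
    exact Set.inter_subset_right
  · right
    obtain ⟨x, hx, hxB⟩ := Set.not_subset.1 h
    rw [← hG.adjoin_inter_eq_of_neighbors hB hC (by omega) hBC hx.2 hxB]
    exact adjoin_subset (isSubspace_span _) (Set.inter_subset_left.trans
      (Set.subset_union_right.trans (subset_span _))) (subset_span _ (Or.inl hx.1))

/-- The triangle A, B, D leaves two cases. If D contains A ∩ B, then so does C ∩ D, and D is
perpendicular to ⟨A, B⟩, hence to C. If D lies in ⟨A, B⟩, both C and D are hyperplanes of it. -/
theorem neighbors_of_between (hG : G.IsPerpSpace) {A B C D : Set P} (hA : G.IsSingular A)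
    (hB : G.IsSingular B) (hC : G.IsSingular C) (hD : G.IsSingular D) (hrB : G.rk A = G.rk B)
    (hrC : G.rk A = G.rk C) (hrD : G.rk A = G.rk D) (hAB : G.Neighbors A B)
    (hAD : G.Neighbors A D) (hBD : G.Neighbors B D) (hABC : A ∩ B ⊆ C)
    (hCAB : C ⊆ G.span (A ∪ B)) (hCD : C ≠ D) : G.Neighbors C D := by
  obtain ⟨sU, rU⟩ := hG.span_union_of_neighbors hA hB hrB hAB
  rcases hG.inter_subset_or_subset_span hA hB hD hrB hrD hAB hAD hBD with h | h
  · refine ⟨hCD, fun c hc d hd => ?_, ?_⟩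
    · refine (hG.perp_span (X := A ∪ B) (fun x hx => ?_) c (hCAB hc)).symm
      exact hx.elim (fun hx => (hAD.2.1 x hx d hd).symm) fun hx => (hBD.2.1 x hx d hd).symm
    · have := hG.rk_mono (hA.inter hB.1) (hC.inter hD.1) (Set.subset_inter hABC h)
      have := hAB.2.2
      omega
  · exact hG.neighbors_of_subset hC hD sU (by omega) hCD (by omega) hCAB h

/-- By ranks D meets ⟨A, B⟩ exactly in A ∩ B. The hyperplane C ∩ D lies in that intersection, so it
equals A ∩ B. -/
theorem inter_subset_of_neighbors (hG : G.IsPerpSpace) {A B C D : Set P} (hA : G.IsSingular A)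
    (hB : G.IsSingular B) (hC : G.IsSingular C) (hD : G.IsSingular D) (hrB : G.rk A = G.rk B)
    (hrC : G.rk A = G.rk C) (hrD : G.rk A = G.rk D) (hAB : G.Neighbors A B)
    (hCD : G.Neighbors C D) (hC' : C ⊆ G.span (A ∪ B)) (hD' : A ∩ B ⊆ D)
    (hDU : ¬ D ⊆ G.span (A ∪ B)) : A ∩ B ⊆ C := by
  obtain ⟨sU, rU⟩ := hG.span_union_of_neighbors hA hB hrB hAB
  have sI := hA.inter hB.1
  have sDU := hD.inter sU.1
  have r1 := hG.rk_inter_of_neighbors hA hB hrB hAB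
  have r2 := hG.rk_inter_of_neighbors hC hD (by omega) hCD
  have r3 : G.rk (D ∩ G.span (A ∪ B)) < G.rk D := by
    by_contra! h
    exact hDU (Set.inter_eq_left.1
      (hG.eq_of_subset_of_rk_le sDU hD Set.inter_subset_left h))
  have e1 : A ∩ B = D ∩ G.span (A ∪ B) := hG.eq_of_subset_of_rk_le sI sDU
    (Set.subset_inter hD' (Set.inter_subset_left.trans
      (Set.subset_union_left.trans (subset_span _)))) (by omega)
  have e2 : C ∩ D = A ∩ B := by
    refine hG.eq_of_subset_of_rk_le (hC.inter hD.1) sI ?_ (by omega)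
    rw [e1]
    exact fun x hx => ⟨hx.2, hC' hx.1⟩
  exact e2 ▸ Set.inter_subset_left

end IsPerpSpace

/-! ### Local embeddings and images of stars -/

/-- The map `F` sends singular subspaces of rank `j` to singular subspaces of rank `J`, and for
subspaces that share a hyperplane it preserves and reflects being neighbors. -/
structure IsLocalEmbedding {P' : Type v} (G : PointLineGeometry P) (G' : PointLineGeometry P')
    (j J : ℕ) (F : Set P → Set P') : Prop where
  isSingular : ∀ X, G.IsSingular X → G.rk X = j → G'.IsSingular (F X)
  rk_eq : ∀ X, G.IsSingular X → G.rk X = j → G'.rk (F X) = J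
  neighbors : ∀ X Y, G.IsSingular X → G.IsSingular Y → G.rk X = j → G.rk Y = j →
    G.Neighbors X Y → G'.Neighbors (F X) (F Y)
  not_neighbors : ∀ X Y, G.IsSingular X → G.IsSingular Y → G.rk X = j → G.rk Y = j →
    j ≤ G.rk (X ∩ Y) + 1 → ¬ G.Perp X Y → F X ≠ F Y ∧ ¬ G'.Neighbors (F X) (F Y)

/-- The common part of the images of the rank `j` singular subspaces containing `R`. -/
def starMap {P' : Type v} (G : PointLineGeometry P) (j : ℕ) (F : Set P → Set P') (R : Set P) :
    Set P' :=
  {y | ∀ X, G.IsSingular X → G.rk X = j → R ⊆ X → y ∈ F X}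

theorem starMap_subset {P' : Type v} {j : ℕ} {F : Set P → Set P'} {R X : Set P}
    (hX : G.IsSingular X) (hr : G.rk X = j) (h : R ⊆ X) : G.starMap j F R ⊆ F X :=
  fun _ hy => hy X hX hr h

namespace IsLocalEmbedding

variable {P' : Type v} {G' : PointLineGeometry P'} {n j J : ℕ} {F : Set P → Set P'} {R : Set P}

theorem neighbors_adjoin (hF : G.IsLocalEmbedding G' j J F) (hG : G.IsPerpSpace)
    (hR : G.IsSingular R) (hj : G.rk R + 1 = j) {x y : P} (hx : x ∈ G.residue R)
    (hy : y ∈ G.residue R) (hxy : G.Collinear x y) (hyx : y ∉ G.adjoin R x) :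
    G'.Neighbors (F (G.adjoin R x)) (F (G.adjoin R y)) := by
  have sx := hG.isSingular_adjoin hR hx.2
  have rx := hG.rk_adjoin hR hx
  exact hF.neighbors _ _ sx (hG.isSingular_adjoin hR hy.2) (by omega)
    (by rw [hG.rk_adjoin hR hy, hj]) (hG.neighbors_adjoin hR sx (subset_adjoin R x) rx
      (hG.mem_residue_adjoin hy hxy.symm hyx))

theorem not_neighbors_adjoin (hF : G.IsLocalEmbedding G' j J F) (hG : G.IsPerpSpace)
    (hR : G.IsSingular R) (hj : G.rk R + 1 = j) {x y : P} (hx : x ∈ G.residue R)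
    (hy : y ∈ G.residue R) (hxy : ¬ G.Collinear x y) :
    F (G.adjoin R x) ≠ F (G.adjoin R y) ∧
      ¬ G'.Neighbors (F (G.adjoin R x)) (F (G.adjoin R y)) := by
  have sx := hG.isSingular_adjoin hR hx.2
  have sy := hG.isSingular_adjoin hR hy.2
  refine hF.not_neighbors _ _ sx sy (by rw [hG.rk_adjoin hR hx, hj])
    (by rw [hG.rk_adjoin hR hy, hj]) ?_ fun h => hxy (h x (mem_adjoin R x) y (mem_adjoin R y))
  have := hG.rk_mono hR (sx.inter sy.1) (Set.subset_inter (subset_adjoin R x) (subset_adjoin R y))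
  omega

/-- Three mutually collinear points in general position of the residue of `R` go to subspaces that
share a hyperplane. -/
theorem inter_subset_of_mem_residue (hF : G.IsLocalEmbedding G' j J F) (hG : G.IsPerpSpace)
    (hG' : G'.IsPerpSpace) (hn : G.HasRank n) (hR : G.IsSingular R) (hj : G.rk R + 1 = j)
    (hjn : j + 3 ≤ n) {a b c : P} (ha : a ∈ G.residue R) (hb : b ∈ G.residue (G.adjoin R a))
    (hc : c ∈ G.residue (G.adjoin (G.adjoin R a) b)) :
    F (G.adjoin R a) ∩ F (G.adjoin R b) ⊆ F (G.adjoin R c) := by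
  have sRa := hG.isSingular_adjoin hR ha.2
  have sN := hG.isSingular_adjoin sRa hb.2
  have rN : G.rk (G.adjoin (G.adjoin R a) b) = j + 1 := by
    rw [hG.rk_adjoin sRa hb, hG.rk_adjoin hR ha]
    omega
  have hRN : R ⊆ G.adjoin (G.adjoin R a) b := (subset_adjoin R a).trans (subset_adjoin _ b)
  have haN : a ∈ G.adjoin (G.adjoin R a) b := subset_adjoin _ b (mem_adjoin R a)
  have hbN : b ∈ G.adjoin (G.adjoin R a) b := mem_adjoin _ b
  have hbR := IsPerpSpace.mem_residue_of_mem_residue_adjoin hb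
  have res : ∀ x ∈ G.residue (G.adjoin (G.adjoin R a) b), x ∈ G.residue R := fun x hx =>
    ⟨fun h => hx.1 (hRN h), fun y hy => hx.2 y (hRN hy)⟩
  have sF : ∀ x ∈ G.residue R, G'.IsSingular (F (G.adjoin R x)) := fun x hx =>
    hF.isSingular _ (hG.isSingular_adjoin hR hx.2) (by rw [hG.rk_adjoin hR hx, hj])
  have rF : ∀ x ∈ G.residue R, G'.rk (F (G.adjoin R x)) = J := fun x hx =>
    hF.rk_eq _ (hG.isSingular_adjoin hR hx.2) (by rw [hG.rk_adjoin hR hx, hj])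
  have nab := hF.neighbors_adjoin hG hR hj ha hbR (hb.2 a (mem_adjoin R a)).symm hb.1
  have nN : ∀ y ∈ G.residue R, y ∈ G.adjoin (G.adjoin R a) b →
      ∀ x ∈ G.residue (G.adjoin (G.adjoin R a) b),
        G'.Neighbors (F (G.adjoin R y)) (F (G.adjoin R x)) := fun y hy hyN x hx =>
    hF.neighbors_adjoin hG hR hj hy (res x hx) (hx.2 y hyN).symm
      fun h => hx.1 (adjoin_subset sN.1 hRN hyN h)
  have na := nN a ha haN
  have nb := nN b hbR hbN
  have rab : G'.rk (F (G.adjoin R a)) = G'.rk (F (G.adjoin R b)) := by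
    rw [rF a ha, rF b hbR]
  have rax : ∀ x ∈ G.residue (G.adjoin (G.adjoin R a) b),
      G'.rk (F (G.adjoin R a)) = G'.rk (F (G.adjoin R x)) := fun x hx => by
    rw [rF a ha, rF x (res x hx)]
  have sep : ∀ x ∈ G.residue (G.adjoin (G.adjoin R a) b),
      ∃ y ∈ G.residue (G.adjoin (G.adjoin R a) b), ¬ G.Collinear x y := by
    intro x hx
    obtain ⟨y, hyN, hyx, _⟩ := hG.separation sN hx
    exact ⟨y, ⟨fun h => hyx (hx.2 y h).symm, hyN⟩, fun h => hyx h.symm⟩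
  have alt : ∀ x ∈ G.residue (G.adjoin (G.adjoin R a) b),
      F (G.adjoin R a) ∩ F (G.adjoin R b) ⊆ F (G.adjoin R x) ∨
        F (G.adjoin R x) ⊆ G'.span (F (G.adjoin R a) ∪ F (G.adjoin R b)) := fun x hx =>
    hG'.inter_subset_or_subset_span (sF a ha) (sF b hbR) (sF x (res x hx)) rab (rax x hx) nab
      (na x hx) (nb x hx)
  -- An image both above the intersection and inside the span would be a neighbor of the image of
  -- every other residue point with a different image, in particular of one belonging to a point not
  -- collinear to x.
  have excl : ∀ x ∈ G.residue (G.adjoin (G.adjoin R a) b),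
      F (G.adjoin R a) ∩ F (G.adjoin R b) ⊆ F (G.adjoin R x) →
        ¬ F (G.adjoin R x) ⊆ G'.span (F (G.adjoin R a) ∪ F (G.adjoin R b)) := by
    intro x hx h1 h2
    obtain ⟨y, hy, hxy⟩ := sep x hx
    have hne := hF.not_neighbors_adjoin hG hR hj (res x hx) (res y hy) hxy
    exact hne.2 (hG'.neighbors_of_between (sF a ha) (sF b hbR) (sF x (res x hx))
      (sF y (res y hy)) rab (rax x hx) (rax y hy) nab (na y hy) (nb y hy) h1 h2 hne.1)
  by_contra hcon
  have htop := (alt c hc).resolve_left hcon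
  have hall : ∀ d ∈ G.residue (G.adjoin (G.adjoin R a) b),
      F (G.adjoin R d) ⊆ G'.span (F (G.adjoin R a) ∪ F (G.adjoin R b)) := by
    intro d hd
    -- Being inside the span passes to adjacent points: if it failed at y, the image of y would
    -- contain the intersection, hence so would that of x, against `excl`. Connectedness needs rk N
    -- + 2 ≤ n with rk N = j + 1, that is, j + 3 ≤ n.
    refine hG.residue_induction hn sN (by omega) (T := fun x => F (G.adjoin R x) ⊆
      G'.span (F (G.adjoin R a) ∪ F (G.adjoin R b))) ?_ hc hd htop
    intro x hx y hy hxy hyx hxT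
    by_contra hyT
    have hyS := (alt y hy).resolve_right hyT
    have nxy := hF.neighbors_adjoin hG hR hj (res x hx) (res y hy) hxy
      fun h => hyx (span_mono (Set.insert_subset_insert hRN) h)
    exact excl x hx (hG'.inter_subset_of_neighbors (sF a ha) (sF b hbR) (sF x (res x hx))
      (sF y (res y hy)) rab (rax x hx) (rax y hy) nab nxy hxT hyS hyT) hxT
  obtain ⟨d, hd, hcd⟩ := sep c hc
  have hne := hF.not_neighbors_adjoin hG hR hj (res c hc) (res d hd) hcd
  obtain ⟨sU, rU⟩ := hG'.span_union_of_neighbors (sF a ha) (sF b hbR) rab nab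
  have rc := rax c hc
  have rd := rax d hd
  -- Two different subspaces of rank J inside one of rank J + 1 are neighbors, although c and d are
  -- not collinear.
  exact hne.2 (hG'.neighbors_of_subset (sF c (res c hc)) (sF d (res d hd)) sU (by omega) hne.1
    (by omega) htop (hall d hd))

/-- The images of the singular subspaces containing `R` share a hyperplane. -/
theorem starMap_spec (hF : G.IsLocalEmbedding G' j J F) (hG : G.IsPerpSpace)
    (hG' : G'.IsPerpSpace) (hn : G.HasRank n) (hR : G.IsSingular R) (hj : G.rk R + 1 = j)
    (hjn : j + 3 ≤ n) :
    G'.IsSingular (G.starMap j F R) ∧ G'.rk (G.starMap j F R) + 1 = J := by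
  obtain ⟨a, ha⟩ := hG.exists_mem_residue hn hR (by omega)
  have sa := hG.isSingular_adjoin hR ha.2
  have ra := hG.rk_adjoin hR ha
  obtain ⟨b, hb⟩ := hG.exists_mem_residue hn sa (by omega)
  have hbR := IsPerpSpace.mem_residue_of_mem_residue_adjoin hb
  have sb := hG.isSingular_adjoin hR hbR.2
  have rb := hG.rk_adjoin hR hbR
  have nab := hF.neighbors_adjoin hG hR hj ha hbR (hb.2 a (mem_adjoin R a)).symm hb.1
  have sFa := hF.isSingular _ sa (by omega)
  have sFb := hF.isSingular _ sb (by omega)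
  have rFa := hF.rk_eq _ sa (by omega)
  have rFb := hF.rk_eq _ sb (by omega)
  have key : ∀ x ∈ G.residue R, ∀ y ∈ G.residue (G.adjoin R x), ∀ z ∈ G.residue (G.adjoin R x),
      F (G.adjoin R x) ∩ F (G.adjoin R y) ⊆ F (G.adjoin R z) := by
    intro x hx y hy z hz
    have sx := hG.isSingular_adjoin hR hx.2
    have rx := hG.rk_adjoin hR hx
    refine hG.residue_induction hn sx (by omega) (T := fun z => F (G.adjoin R x) ∩
      F (G.adjoin R y) ⊆ F (G.adjoin R z)) ?_ hy hz Set.inter_subset_right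
    intro c hc d hd hcd hdc hcT
    exact (Set.subset_inter Set.inter_subset_left hcT).trans
      (hF.inter_subset_of_mem_residue hG hG' hn hR hj hjn hx hc
        (hG.mem_residue_adjoin hd hcd.symm hdc))
  have all : ∀ x ∈ G.residue R,
      F (G.adjoin R a) ∩ F (G.adjoin R b) ⊆ F (G.adjoin R x) := by
    intro x hx
    -- The inclusion for x alone does not propagate. Carrying it also for all y in the residue of
    -- ⟨R, x⟩ makes it available at both d and c, and `key` continues from that pair.
    refine (hG.residue_induction hn hR (by omega) (T := fun x =>
      F (G.adjoin R a) ∩ F (G.adjoin R b) ⊆ F (G.adjoin R x) ∧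
        ∀ y ∈ G.residue (G.adjoin R x), F (G.adjoin R a) ∩ F (G.adjoin R b) ⊆ F (G.adjoin R y))
      ?_ ha hx ⟨Set.inter_subset_left, fun y hy => key a ha b hb y hy⟩).1
    intro c hc d hd hcd hdc hT
    have h1 := hT.2 d (hG.mem_residue_adjoin hd hcd.symm hdc)
    refine ⟨h1, fun y hy => (Set.subset_inter h1 hT.1).trans (key d hd c ?_ y hy)⟩
    exact hG.mem_residue_adjoin hc hcd (hG.notMem_adjoin_comm hR hc hd hdc)
  have heq : G.starMap j F R = F (G.adjoin R a) ∩ F (G.adjoin R b) := by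
    apply Set.Subset.antisymm
    · exact Set.subset_inter (starMap_subset sa (by omega) (subset_adjoin R a))
        (starMap_subset sb (by omega) (subset_adjoin R b))
    · intro y hy X hX hrX hRX
      obtain ⟨x, hx, rfl⟩ := hG.exists_adjoin_eq hR hX hRX (by omega)
      exact all x hx hy
  rw [heq]
  exact ⟨sFa.inter sFb.1, by rw [hG'.rk_inter_of_neighbors sFa sFb (by omega) nab, rFa]⟩

/-- Restricting to stars gives a local embedding one rank lower, provided that it separates
subspaces with a common hyperplane. -/
theorem starMap_isLocalEmbedding (hF : G.IsLocalEmbedding G' (j + 1) J F) (hG : G.IsPerpSpace)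
    (hG' : G'.IsPerpSpace) (hn : G.HasRank n) (hjn : j + 4 ≤ n)
    (hinj : ∀ S T, G.IsSingular S → G.IsSingular T → G.rk S = j → G.rk T = j →
      j ≤ G.rk (S ∩ T) + 1 → S ≠ T → G.starMap (j + 1) F S ≠ G.starMap (j + 1) F T) :
    G.IsLocalEmbedding G' j (J - 1) (G.starMap (j + 1) F) := by
  have spec : ∀ R, G.IsSingular R → G.rk R = j → G'.IsSingular (G.starMap (j + 1) F R) ∧
      G'.rk (G.starMap (j + 1) F R) + 1 = J := fun R hR hr =>
    hF.starMap_spec hG hG' hn hR (by omega) (by omega)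
  have hnb : ∀ S T, G.IsSingular S → G.IsSingular T → G.rk S = j → G.rk T = j →
      G.Neighbors S T → G'.Neighbors (G.starMap (j + 1) F S) (G.starMap (j + 1) F T) := by
    intro S T hS hT rS rT h
    obtain ⟨U, hU, rU, hSU, hTU, _⟩ := hG.exists_join hS hT (by omega) h
    have rFU := hF.rk_eq U hU (by omega)
    have hS' := spec S hS rS
    have hT' := spec T hT rT
    exact hG'.neighbors_of_subset hS'.1 hT'.1 (hF.isSingular U hU (by omega)) (by omega)
      (hinj S T hS hT rS rT (rS ▸ h.2.2) h.1) (by omega)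
      (starMap_subset hU (by omega) hSU) (starMap_subset hU (by omega) hTU)
  refine ⟨fun R hR hr => (spec R hR hr).1, fun R hR hr => ?_, hnb, ?_⟩
  · have := (spec R hR hr).2
    omega
  intro S T hS hT rS rT hST hnp
  have hne : S ≠ T := by
    rintro rfl
    exact hnp (hG.perp_self hS)
  have hgne := hinj S T hS hT rS rT hST hne
  refine ⟨hgne, fun hgn => ?_⟩
  have sQ := hS.inter hT.1
  have rQ := hG.rk_inter_lt hS hT (by omega) hne
  obtain ⟨s, hs, hsS⟩ := hG.exists_adjoin_eq sQ hS Set.inter_subset_left (by omega)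
  obtain ⟨t, ht, htT⟩ := hG.exists_adjoin_eq sQ hT Set.inter_subset_right (by omega)
  have hst : ¬ G.Collinear s t := by
    intro hst
    have hp : G.Perp (G.adjoin (S ∩ T) s) (G.adjoin (S ∩ T) t) := by
      refine hG.span_perp_span ?_
      rintro x (rfl | hx) y (rfl | hy)
      exacts [hst, hs.2 y hy, (ht.2 x hx).symm, hG.perp_self sQ x hx y hy]
    rw [hsS, htT] at hp
    exact hnp hp
  -- With E = ⟨S ∩ T, e⟩, the images of ⟨S, e⟩ and ⟨T, e⟩ are spanned by the star images of S, E and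
  -- of T, E. If the star images of S and T were neighbors, these two images would be perpendicular
  -- and share the star image of E as a hyperplane, although ⟨S, e⟩ and ⟨T, e⟩ are not
  -- perpendicular.
  obtain ⟨e, he, hes, het, heS, heT⟩ := hG.exists_common_neighbor hn sQ (by omega) hs ht hst
  have heS' : e ∈ G.residue S := hsS ▸ hG.mem_residue_adjoin he hes heS
  have heT' : e ∈ G.residue T := htT ▸ hG.mem_residue_adjoin he het heT
  have sE := hG.isSingular_adjoin sQ he.2
  have rE := hG.rk_adjoin sQ he
  have sX := hG.isSingular_adjoin hS heS'.2
  have rX := hG.rk_adjoin hS heS'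
  have sY := hG.isSingular_adjoin hT heT'.2
  have rY := hG.rk_adjoin hT heT'
  have hEX : G.adjoin (S ∩ T) e ⊆ G.adjoin S e :=
    span_mono (Set.insert_subset_insert Set.inter_subset_left)
  have hEY : G.adjoin (S ∩ T) e ⊆ G.adjoin T e :=
    span_mono (Set.insert_subset_insert Set.inter_subset_right)
  have nSE : G.Neighbors S (G.adjoin (S ∩ T) e) :=
    hG.neighbors_adjoin sQ hS Set.inter_subset_left (by omega) heS'
  have nTE : G.Neighbors T (G.adjoin (S ∩ T) e) :=
    hG.neighbors_adjoin sQ hT Set.inter_subset_right (by omega) heT'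
  have nXY := hF.not_neighbors _ _ sX sY (by omega) (by omega)
    (by have := hG.rk_mono sE (sX.inter sY.1) (Set.subset_inter hEX hEY); omega)
    fun h => hnp (h.mono (subset_adjoin S e) (subset_adjoin T e))
  have sFX := hF.isSingular _ sX (by omega)
  have sFY := hF.isSingular _ sY (by omega)
  have rFX := hF.rk_eq _ sX (by omega)
  have rFY := hF.rk_eq _ sY (by omega)
  have hgS := spec S hS rS
  have hgT := spec T hT rT
  have hgE := spec _ sE (by omega)
  have hgEX : G.starMap (j + 1) F (G.adjoin (S ∩ T) e) ⊆ F (G.adjoin S e) :=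
    starMap_subset sX (by omega) hEX
  have hgEY : G.starMap (j + 1) F (G.adjoin (S ∩ T) e) ⊆ F (G.adjoin T e) :=
    starMap_subset sY (by omega) hEY
  have hgSX : G.starMap (j + 1) F S ⊆ F (G.adjoin S e) :=
    starMap_subset sX (by omega) (subset_adjoin S e)
  have hgTY : G.starMap (j + 1) F T ⊆ F (G.adjoin T e) :=
    starMap_subset sY (by omega) (subset_adjoin T e)
  have eX := hG'.eq_span_union hgS.1 hgE.1 sFX hgSX hgEX (by omega) (by omega)
    (hnb S _ hS sE rS (by omega) nSE).1
  have eY := hG'.eq_span_union hgT.1 hgE.1 sFY hgTY hgEY (by omega) (by omega)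
    (hnb T _ hT sE rT (by omega) nTE).1
  refine nXY.2 ⟨nXY.1, ?_, ?_⟩
  · have pX := hG'.perp_self sFX
    have pY := hG'.perp_self sFY
    rw [eX, eY]
    refine hG'.span_perp_span ?_
    rintro x (hx | hx) y (hy | hy)
    · exact hgn.2.1 x hx y hy
    · exact pX x (hgSX hx) y (hgEX hy)
    · exact pY x (hgEY hx) y (hgTY hy)
    · exact pX x (hgEX hx) y (hgEX hy)
  · have := hG'.rk_mono hgE.1 (sFX.inter sFY.1) (Set.subset_inter hgEX hgEY)
    omega

end IsLocalEmbedding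
-- Excluding maximal singular subspaces as targets
variable {P' : Type v} {G' : PointLineGeometry P'}

open Classical in
/-- The extension by `∅` of a map between Grassmannians to all sets of points. -/
noncomputable def extendMap {k k' : ℤ} (f : G.grassmannian k → G'.grassmannian k') (X : Set P) :
    Set P' :=
  if h : X ∈ G.grassmannian k then (f ⟨X, h⟩).1 else ∅

theorem extendMap_apply {k k' : ℤ} (f : G.grassmannian k → G'.grassmannian k')
    (X : G.grassmannian k) : extendMap f X.1 = (f X).1 := by
  rw [extendMap, dif_pos X.2]

namespace IsPerpSpace

theorem exists_singular_rk (hG : G.IsPerpSpace) {n : ℕ} (hn : G.HasRank n) {m : ℕ}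
    (hm : m ≤ n) : ∃ X, G.IsSingular X ∧ G.rk X = m := by
  induction m with
  | zero => exact ⟨∅, isSingular_empty, hG.rk_empty⟩
  | succ m ih =>
    obtain ⟨X, hX, rX⟩ := ih (by omega)
    obtain ⟨p, hp⟩ := hG.exists_mem_residue hn hX (by omega)
    exact ⟨_, hG.isSingular_adjoin hX hp.2, by rw [hG.rk_adjoin hX hp, rX]⟩

/-- Among the maximal singular subspaces, mutual neighbors share a hyperplane. -/
theorem inter_subset_of_maximal (hG : G.IsPerpSpace) {n : ℕ} (hn : G.HasRank n) {A B C : Set P}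
    (hA : G.IsSingular A) (hB : G.IsSingular B) (hC : G.IsSingular C) (rC : G.rk C = n)
    (hAB : G.rk (A ∩ B) + 1 = n) (hAC : G.rk (A ∩ C) + 1 = n) (hBC : G.rk (B ∩ C) + 1 = n) :
    A ∩ B ⊆ C := by
  by_cases h : A ∩ C ⊆ B
  · rw [← hG.eq_of_subset_of_rk_le (hA.inter hC.1) (hA.inter hB.1)
      (Set.subset_inter Set.inter_subset_left h) (by omega)]
    exact Set.inter_subset_right
  · obtain ⟨x, hx, hxB⟩ := Set.not_subset.1 h
    have hCe := hG.adjoin_eq_of_rk (hB.inter hC.1) hC Set.inter_subset_right (by omega) hx.2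
      fun h => hxB h.1
    intro y hy
    by_contra hyC
    have hyr : y ∈ G.residue C := ⟨hyC, hCe ▸ hG.perp_adjoin
      (fun z hz => hG.perp_self hB y hy.2 z hz.1) (hG.perp_self hA y hy.1 x hx.1)⟩
    have := hG.rk_le hn (hG.isSingular_adjoin hC hyr.2)
    rw [hG.rk_adjoin hC hyr] at this
    omega

/-- A Grassmann graph with two triangles on a common edge whose other vertices are not adjacent
does not embed in a dual polar graph. -/
theorem not_maximal_of_embedding (hG : G.IsPerpSpace) (hG' : G'.IsPerpSpace) {n n' k k' : ℕ}
    (hn : G.HasRank n) (hn' : G'.HasRank n') (hkn : k + 4 ≤ n)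
    (f : G.grassmannGraph n k ↪g G'.grassmannGraph n' k') : k' + 2 ≤ n' := by
  obtain ⟨R, hR, rR⟩ := hG.exists_singular_rk hn (m := k) (by omega)
  obtain ⟨a, ha⟩ := hG.exists_mem_residue hn hR (by omega)
  have sa := hG.isSingular_adjoin hR ha.2
  have ra := hG.rk_adjoin hR ha
  obtain ⟨b, hb⟩ := hG.exists_mem_residue hn sa (by omega)
  have sab := hG.isSingular_adjoin sa hb.2
  have rab := hG.rk_adjoin sa hb
  obtain ⟨c, hc⟩ := hG.exists_mem_residue hn sab (by omega)
  obtain ⟨d, hd, hdc, _⟩ := hG.separation sab hc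
  have hRN : R ⊆ G.adjoin (G.adjoin R a) b := (subset_adjoin R a).trans (subset_adjoin _ b)
  have res : ∀ x ∈ G.residue (G.adjoin (G.adjoin R a) b), x ∈ G.residue R := fun x hx =>
    ⟨fun h => hx.1 (hRN h), fun y hy => hx.2 y (hRN hy)⟩
  have hbR := mem_residue_of_mem_residue_adjoin hb
  have hd' : d ∈ G.residue (G.adjoin (G.adjoin R a) b) :=
    ⟨fun h => hdc (hc.2 d h).symm, hd⟩
  let vertex : G.residue R → G.grassmannian k := fun x => ⟨G.adjoin R x.1,
    hG.mem_grassmannian.2 ⟨hG.isSingular_adjoin hR x.2.2, by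
      rw [hG.rk_adjoin hR x.2, rR]; push_cast; ring⟩⟩
  have adj : ∀ x y : G.residue R, G.Collinear x.1 y.1 → y.1 ∉ G.adjoin R x.1 →
      (G.grassmannGraph n k).Adj (vertex x) (vertex y) := fun x y hxy hyx =>
    (hG.adj_iff (by omega) _ _).2 (hG.neighbors_adjoin hR (hG.isSingular_adjoin hR x.2.2)
      (subset_adjoin R x.1) (hG.rk_adjoin hR x.2) (hG.mem_residue_adjoin y.2 hxy.symm hyx))
  have haN : a ∈ G.adjoin (G.adjoin R a) b := subset_adjoin _ b (mem_adjoin R a)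
  have hbN : b ∈ G.adjoin (G.adjoin R a) b := mem_adjoin _ b
  have adjN : ∀ (y : G.residue R), y.1 ∈ G.adjoin (G.adjoin R a) b →
      ∀ x (hx : x ∈ G.residue (G.adjoin (G.adjoin R a) b)),
        (G.grassmannGraph n k).Adj (vertex y) (vertex ⟨x, res x hx⟩) := fun y hyN x hx =>
    adj _ _ (hx.2 y.1 hyN).symm fun h => hx.1 (adjoin_subset sab.1 hRN hyN h)
  have eab := f.map_adj_iff.2
    (adj ⟨a, ha⟩ ⟨b, hbR⟩ (hb.2 a (mem_adjoin R a)).symm hb.1)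
  have eac := f.map_adj_iff.2 (adjN ⟨a, ha⟩ haN c hc)
  have ebc := f.map_adj_iff.2 (adjN ⟨b, hbR⟩ hbN c hc)
  have ead := f.map_adj_iff.2 (adjN ⟨a, ha⟩ haN d hd')
  have ebd := f.map_adj_iff.2 (adjN ⟨b, hbR⟩ hbN d hd')
  have hne : vertex ⟨c, res c hc⟩ ≠ vertex ⟨d, res d hd'⟩ := by
    intro h
    have h1 : G.adjoin R c = G.adjoin R d := congrArg Subtype.val h
    exact hdc (hG.perp_self (hG.isSingular_adjoin hR (res c hc).2) d (h1 ▸ mem_adjoin R d) c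
      (mem_adjoin R c))
  have hnadj : ¬ (G.grassmannGraph n k).Adj (vertex ⟨c, res c hc⟩) (vertex ⟨d, res d hd'⟩) :=
    fun h => hdc (((hG.adj_iff (by omega) _ _).1 h).2.1 c (mem_adjoin R c) d
      (mem_adjoin R d)).symm
  by_contra hk'
  have hk'n : k' + 1 = n' := by
    have := hG'.rk_le hn' (f (vertex ⟨a, ha⟩)).2.1
    rw [hG'.rk_vertex] at this
    omega
  have rI : ∀ X Y : G'.grassmannian k', (G'.grassmannGraph n' k').Adj X Y →
      G'.rk (X.1 ∩ Y.1) + 1 = n' := by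
    rintro X Y ⟨_, ⟨h, _⟩ | ⟨_, h⟩⟩
    · omega
    · have := (hG'.hasDim_iff (X.2.1.inter Y.2.1.1)).1 h
      omega
  have rV : ∀ X : G'.grassmannian k', G'.rk X.1 = n' := fun X => by
    rw [hG'.rk_vertex, hk'n]
  -- The images of c and d both contain the hyperplane f(a) ∩ f(b), so they would be adjacent, while
  -- c and d are not collinear.
  have hC := hG'.inter_subset_of_maximal hn' (f _).2.1 (f _).2.1 (f _).2.1 (rV _)
    (rI _ _ eab) (rI _ _ eac) (rI _ _ ebc)
  have hD := hG'.inter_subset_of_maximal hn' (f _).2.1 (f _).2.1 (f _).2.1 (rV _)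
    (rI _ _ eab) (rI _ _ ead) (rI _ _ ebd)
  have hfne := f.injective.ne hne
  refine hnadj (f.map_adj_iff.1 ⟨hfne, Or.inr ⟨by omega, ?_⟩⟩)
  have sI := (f (vertex ⟨c, res c hc⟩)).2.1.inter (f (vertex ⟨d, res d hd'⟩)).2.1.1
  have h1 := hG'.rk_mono ((f _).2.1.inter (f _).2.1.1) sI (Set.subset_inter hC hD)
  have h2 := hG'.rk_inter_lt (f _).2.1 (f _).2.1 (by rw [rV, rV])
    fun h => hfne (Subtype.ext h)
  have h3 := rI _ _ eab
  rw [rV] at h2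
  exact (hG'.hasDim_iff sI).2 (by omega)

end IsPerpSpace

/-! ### The descent to points -/

/-- The data obtained by descending from rank `k + 1` to rank `i`. -/
structure IsDescent (G : PointLineGeometry P) (G' : PointLineGeometry P') {k k' : ℕ}
    (f : G.grassmannian k → G'.grassmannian k') (i J : ℕ) (F : Set P → Set P') : Prop where
  isLocalEmbedding : G.IsLocalEmbedding G' i J F
  rank_add : J + (k + 1) = (k' + 1) + i
  subset : ∀ R (X : G.grassmannian k), G.IsSingular R → G.rk R = i → R ⊆ X.1 → F R ⊆ (f X).1
  spanned : ∀ (X : G.grassmannian k) (T : Set P'), G'.IsSubspace T →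
    (∀ R, G.IsSingular R → G.rk R = i → R ⊆ X.1 → F R ⊆ T) → (f X).1 ⊆ T

section Descent

variable {n n' k k' : ℕ}

theorem isDescent_extendMap (hG : G.IsPerpSpace) (hG' : G'.IsPerpSpace) (hkn : k + 2 ≤ n)
    (hkn' : k' + 2 ≤ n') (f : G.grassmannGraph n k ↪g G'.grassmannGraph n' k') :
    G.IsDescent G' f (k + 1) (k' + 1) (extendMap f) := by
  have lift : ∀ X, G.IsSingular X → G.rk X = k + 1 → ∃ V : G.grassmannian k, V.1 = X :=
    fun X hX hr => ⟨⟨X, hG.mem_grassmannian.2 ⟨hX, by omega⟩⟩, rfl⟩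
  refine ⟨⟨?_, ?_, ?_, ?_⟩, by omega, ?_, ?_⟩
  · intro X hX hr
    obtain ⟨V, rfl⟩ := lift X hX hr
    rw [extendMap_apply]
    exact (f V).2.1
  · intro X hX hr
    obtain ⟨V, rfl⟩ := lift X hX hr
    rw [extendMap_apply]
    exact hG'.rk_vertex _
  · intro X Y hX hY hr hr' h
    obtain ⟨V, rfl⟩ := lift X hX hr
    obtain ⟨W, rfl⟩ := lift Y hY hr'
    rw [extendMap_apply, extendMap_apply]
    exact (hG'.adj_iff hkn' _ _).1 (f.map_adj_iff.2 ((hG.adj_iff hkn V W).2 h))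
  · intro X Y hX hY hr hr' _ hnp
    obtain ⟨V, rfl⟩ := lift X hX hr
    obtain ⟨W, rfl⟩ := lift Y hY hr'
    rw [extendMap_apply, extendMap_apply]
    refine ⟨fun h => hnp ?_, fun h => hnp ?_⟩
    · rw [f.injective (Subtype.ext h)]
      exact hG.perp_self hY
    · exact ((hG.adj_iff hkn V W).1 (f.map_adj_iff.1 ((hG'.adj_iff hkn' _ _).2 h))).2.1
  · intro R X hR hr hRX
    rw [hG.eq_of_subset_of_rk_le hR X.2.1 hRX (by rw [hr, hG.rk_vertex]), extendMap_apply]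
  · intro X T _ h
    rw [← extendMap_apply]
    exact h X.1 X.2.1 (hG.rk_vertex X) subset_rfl

/-- The only point where distances, and not just adjacency, are used: they show that star images
separate subspaces with a common hyperplane. -/
theorem IsDescent.succ (hG : G.IsPerpSpace) (hG' : G'.IsPerpSpace) (hn : G.HasRank n)
    (hn' : G'.HasRank n') (hkn : k + 4 ≤ n) (hkn' : k' + 2 ≤ n')
    (f : G.grassmannGraph n k ↪g G'.grassmannGraph n' k')
    (hf : ∀ X Y, (G'.grassmannGraph n' k').edist (f X) (f Y) =
      (G.grassmannGraph n k).edist X Y) {i J : ℕ} {F : Set P → Set P'}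
    (h : G.IsDescent G' f (i + 1) J F) (hi : 1 ≤ i) (hik : i ≤ k) :
    G.IsDescent G' f i (J - 1) (G.starMap (i + 1) F) := by
  have spec : ∀ R, G.IsSingular R → G.rk R = i → G'.IsSingular (G.starMap (i + 1) F R) ∧
      G'.rk (G.starMap (i + 1) F R) + 1 = J := fun R hR hr =>
    h.isLocalEmbedding.starMap_spec hG hG' hn hR (by omega) (by omega)
  have hsub : ∀ R (X : G.grassmannian k), G.IsSingular R → G.rk R = i → R ⊆ X.1 →
      G.starMap (i + 1) F R ⊆ (f X).1 := by
    intro R X hR hr hRX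
    have rX := hG.rk_vertex X
    obtain ⟨p, hp, hpR⟩ := hG.exists_mem_notMem hR X.2.1 (by omega)
    have hpr := hG.mem_residue_of_mem X.2.1 hRX hp hpR
    have sA := hG.isSingular_adjoin hR hpr.2
    have rA := hG.rk_adjoin hR hpr
    exact (starMap_subset sA (by omega) (subset_adjoin R p)).trans
      (h.subset _ X sA (by omega) (adjoin_subset X.2.1.1 hRX hp))
  have hinj : ∀ S T, G.IsSingular S → G.IsSingular T → G.rk S = i → G.rk T = i →
      i ≤ G.rk (S ∩ T) + 1 → S ≠ T → G.starMap (i + 1) F S ≠ G.starMap (i + 1) F T := by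
    intro S T hS hT rS rT hST hne heq
    have sQ := hS.inter hT.1
    have rQ := hG.rk_inter_lt hS hT (by omega) hne
    obtain ⟨s, hs, hsS⟩ := hG.exists_adjoin_eq sQ hS Set.inter_subset_left (by omega)
    obtain ⟨t, ht, htT⟩ := hG.exists_adjoin_eq sQ hT Set.inter_subset_right (by omega)
    have hts : t ∉ G.adjoin (S ∩ T) s := by
      intro hts
      have := hG.adjoin_eq_of_mem sQ hs hts ht.1
      rw [hsS, htT] at this
      exact hne this.symm
    obtain ⟨X, Y, hopp, hX, hY, rX, rY⟩ := hG.exists_oppositeOver hn sQ hs ht hts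
      (K := k + 1) (by omega) (by omega)
    rw [hsS] at hX
    rw [htT] at hY
    let V : G.grassmannian k := ⟨X, hG.mem_grassmannian.2 ⟨hopp.left, by omega⟩⟩
    let W : G.grassmannian k := ⟨Y, hG.mem_grassmannian.2 ⟨hopp.right, by omega⟩⟩
    -- Since rk (S ∩ T) = i − 1, the distance of X and Y exceeds k + 2 − i. Their images share a
    -- subspace of rank J − 1, which by `rank_add` has codimension k + 1 − i in them, so their
    -- distance is at most k + 2 − i.
    have h1 := hG.lt_edist_of_oppositeOver (n := n) (by omega) (X := V) (Y := W) hopp (by omega)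
      (e := k + 1 - G.rk (S ∩ T)) (by omega)
    have hgS := spec S hS rS
    have h2 := hG'.rk_mono hgS.1 ((f V).2.1.inter (f W).2.1.1)
      (Set.subset_inter (hsub S V hS rS hX) (heq ▸ hsub T W hT rT hY))
    have h3 := h.rank_add
    have h4 := hG'.edist_le hn' hkn' (X := f V) (Y := f W) (e := k + 1 - i) (by omega)
    rw [hf] at h4
    have h5 := h1.trans_le h4
    have h6 : k + 1 - G.rk (S ∩ T) < k + 1 - i + 1 := by exact_mod_cast h5
    omega
  have hloc := h.isLocalEmbedding.starMap_isLocalEmbedding hG hG' hn (by omega) hinj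
  refine ⟨hloc, ?_, hsub, ?_⟩
  · obtain ⟨R, hR, rR⟩ := hG.exists_singular_rk hn (m := i) (by omega)
    have h1 := h.rank_add
    have h2 := (spec R hR rR).2
    omega
  intro X T hT hall
  refine h.spanned X T hT fun R hR rR hRX => ?_
  -- Any two distinct hyperplanes A, B of R have star images that span F R. They exist because R has
  -- rank i + 1 ≥ 2: take A, then B through a point p outside A.
  obtain ⟨A, hA, _, hAR, rA⟩ := hG.exists_hyperplane IsPerpSpace.isSingular_empty hR
    (Set.empty_subset R) (by rw [hG.rk_empty]; omega)
  obtain ⟨p, hp, hpA⟩ := hG.exists_mem_notMem hA hR (by omega)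
  have hp0 : p ∈ G.residue ∅ := ⟨Set.notMem_empty p, fun _ h => h.elim⟩
  have sp := hG.isSingular_adjoin IsPerpSpace.isSingular_empty hp0.2
  have rp := hG.rk_adjoin IsPerpSpace.isSingular_empty hp0
  rw [hG.rk_empty] at rp
  obtain ⟨B, hB, hpB, hBR, rB⟩ := hG.exists_hyperplane sp hR
    (adjoin_subset hR.1 (Set.empty_subset R) hp) (by omega)
  have hAB : A ≠ B := by
    rintro rfl
    exact hpA (hpB (mem_adjoin ∅ p))
  have hnb := hG.neighbors_of_subset hA hB hR (by omega) hAB (by omega) hAR hBR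
  have hgA := spec A hA (by omega)
  have hgB := spec B hB (by omega)
  have hFR := h.isLocalEmbedding.rk_eq R hR rR
  rw [hG'.eq_span_union hgA.1 hgB.1 (h.isLocalEmbedding.isSingular R hR rR)
    (starMap_subset hR rR hAR) (starMap_subset hR rR hBR) (by omega) (by omega)
    (hloc.neighbors A B hA hB (by omega) (by omega) hnb).1]
  exact span_subset hT (Set.union_subset (hall A hA (by omega) (hAR.trans hRX))
    (hall B hB (by omega) (hBR.trans hRX)))

theorem exists_isDescent (hG : G.IsPerpSpace) (hG' : G'.IsPerpSpace) (hn : G.HasRank n)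
    (hn' : G'.HasRank n') (hkn : k + 4 ≤ n)
    (f : G.grassmannGraph n k ↪g G'.grassmannGraph n' k')
    (hf : ∀ X Y, (G'.grassmannGraph n' k').edist (f X) (f Y) =
      (G.grassmannGraph n k).edist X Y) : ∃ J F, G.IsDescent G' f 1 J F := by
  have hkn' := hG.not_maximal_of_embedding hG' hn hn' hkn f
  have : ∀ d ≤ k, ∃ J F, G.IsDescent G' f (k + 1 - d) J F := by
    intro d
    induction d with
    | zero => exact fun _ => ⟨_, _, isDescent_extendMap hG hG' (by omega) hkn' f⟩
    | succ d ih =>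
      intro hd
      obtain ⟨J, F, h⟩ := ih (by omega)
      rw [show k + 1 - d = k + 1 - (d + 1) + 1 by omega] at h
      exact ⟨_, _, h.succ hG hG' hn hn' hkn hkn' f hf (by omega) (by omega)⟩
  simpa using this k le_rfl

end Descent
-- Polar and thin polar spaces satisfy the common axioms
theorem IsPolarSpace.isPerpSpace (h : G.IsPolarSpace) : G.IsPerpSpace where
  exists_line := h.exists_line
  exists_collinear p L hL := by
    rcases h.one_or_all p L hL with ⟨q, hq, _⟩ | hall
    · exact ⟨q, hq⟩
    · obtain ⟨q, hq⟩ := (h.line_nontrivial L hL).nonempty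
      exact ⟨q, hq, hall q hq⟩
  collinear_line p L hL q hq r hr hqr hpq hpr := by
    rcases h.one_or_all p L hL with ⟨x, _, hx⟩ | hall
    · exact absurd ((hx q ⟨hq, hpq⟩).trans (hx r ⟨hr, hpr⟩).symm) hqr
    · exact hall
  exists_not_collinear p := by
    by_contra! hp
    exact h.not_collinear_all ⟨p, hp⟩
  finite_chain := h.finite_chain

section Thin

variable {n : ℕ} {α : P ≃ Fin n × Bool}

theorem mem_lines_of_thin (hα : (fun L => α '' L) '' G.lines = (standardThin n).lines)
    {L : Set P} : L ∈ G.lines ↔ ∃ x y, (α x).1 ≠ (α y).1 ∧ L = {x, y} := by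
  have himg : ∀ M : Set P, α '' M ∈ (standardThin n).lines ↔ M ∈ G.lines := by
    intro M
    rw [← hα]
    exact (α.injective.image_injective).mem_set_image
  rw [← himg]
  constructor
  · rintro ⟨x, y, hxy, hL⟩
    refine ⟨α.symm x, α.symm y, by simpa using hxy, ?_⟩
    apply α.injective.image_injective
    simp only [hL, Set.image_pair, Equiv.apply_symm_apply]
  · rintro ⟨x, y, hxy, rfl⟩
    exact ⟨α x, α y, hxy, Set.image_pair _ _ _⟩

theorem collinear_of_thin (hα : (fun L => α '' L) '' G.lines = (standardThin n).lines)
    (hn : 2 ≤ n) {x y : P} : G.Collinear x y ↔ x = y ∨ (α x).1 ≠ (α y).1 := by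
  constructor
  · rintro ⟨L, hL, hx, hy⟩
    obtain ⟨a, b, hab, rfl⟩ := (mem_lines_of_thin hα).1 hL
    rcases hx with rfl | rfl <;> rcases hy with rfl | rfl
    exacts [Or.inl rfl, Or.inr hab, Or.inr hab.symm, Or.inl rfl]
  · rintro (rfl | hxy)
    · have : Nontrivial (Fin n) := Fin.nontrivial_iff_two_le.2 hn
      obtain ⟨i, hi⟩ := exists_ne (α x).1
      exact ⟨{x, α.symm (i, true)}, (mem_lines_of_thin hα).2
        ⟨x, _, by simpa using hi.symm, rfl⟩, by simp, by simp⟩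
    · exact ⟨{x, y}, (mem_lines_of_thin hα).2 ⟨x, y, hxy, rfl⟩, by simp, by simp⟩

/-- A line has only two points, so a set containing two points of it contains the line. Hence every
set is its own span. -/
theorem isSubspace_of_thin (hα : (fun L => α '' L) '' G.lines = (standardThin n).lines)
    (S : Set P) : G.IsSubspace S := by
  intro p hp q hq hpq L hL hpL hqL x hx
  obtain ⟨a, b, hab, rfl⟩ := (mem_lines_of_thin hα).1 hL
  grind

theorem IsThinPolarSpace.isPerpSpace (h : G.IsThinPolarSpace n) (hn : 2 ≤ n) :
    G.IsPerpSpace := by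
  obtain ⟨α, hα⟩ := h
  have hfin : Finite P := Finite.of_equiv _ α.symm
  refine ⟨fun p => ?_, ?_, ?_, ?_, fun C _ _ => Set.toFinite C⟩
  · obtain ⟨L, hL, hp, _⟩ := (collinear_of_thin hα hn (x := p)).2 (Or.inl rfl)
    exact ⟨L, hL, hp⟩
  · intro p L hL
    obtain ⟨a, b, hab, rfl⟩ := (mem_lines_of_thin hα).1 hL
    by_cases hpa : (α p).1 = (α a).1
    · exact ⟨b, by simp, (collinear_of_thin hα hn).2 (Or.inr (hpa ▸ hab))⟩
    · exact ⟨a, by simp, (collinear_of_thin hα hn).2 (Or.inr hpa)⟩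
  · intro p L hL q hq r hr hqr hpq hpr s hs
    obtain ⟨a, b, hab, rfl⟩ := (mem_lines_of_thin hα).1 hL
    grind
  · intro p
    refine ⟨α.symm ((α p).1, !(α p).2), fun h => ?_⟩
    rcases (collinear_of_thin hα hn).1 h with h | h
    · have := congrArg (fun x => (α x).2) h
      simp at this
    · simp at h

/-- A maximal singular subspace contains exactly one point of each opposite pair, and its only
spanning set is itself. -/
theorem IsThinPolarSpace.hasRank (h : G.IsThinPolarSpace n) (hn : 2 ≤ n) : G.HasRank n := by
  have hG := h.isPerpSpace hn
  obtain ⟨α, hα⟩ := h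
  have hfin : Finite P := Finite.of_equiv _ α.symm
  intro M hM
  have hspan : ∀ S : Set P, G.span S = S := fun S => (isSubspace_of_thin hα S).span_eq
  have hinj : Set.InjOn (fun x => (α x).1) M := by
    intro x hx y hy hxy
    by_contra hne
    exact ((collinear_of_thin hα hn).1 (hM.1.2 x hx y hy hne)).elim hne fun h => h hxy
  have himg : (fun x => (α x).1) '' M = Set.univ := by
    refine Set.eq_univ_of_forall fun i => ?_
    by_contra hi
    have hp : ∀ x ∈ M, G.Collinear (α.symm (i, true)) x := fun x hx =>
      (collinear_of_thin hα hn).2 (Or.inr fun h => hi ⟨x, hx, by simpa using h.symm⟩)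
    have := hM.2 (hG.isSingular_adjoin hM.1 hp) (subset_adjoin M _)
    exact hi ⟨_, this (mem_adjoin M _), by simp⟩
  have hcard : M.ncard = n := by
    rw [← hinj.ncard_image, himg, Set.ncard_univ, Nat.card_eq_fintype_card,
      Fintype.card_fin]
  refine ⟨⟨M.toFinite.toFinset, ?_, ?_⟩, ?_⟩
  · rw [hspan, Set.Finite.coe_toFinset]
  · rw [← Set.ncard_eq_toFinset_card M, hcard]
  · rintro _ ⟨X, hX, rfl⟩
    rw [hspan] at hX
    rw [← hcard, ← hX, Set.ncard_coe_finset]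

end Thin
-- The quotient by a singular subspace
theorem mem_residue_empty (p : P) : p ∈ G.residue ∅ := ⟨Set.notMem_empty p, fun _ h => h.elim⟩

theorem adjoin_empty (p : P) : G.adjoin ∅ p = {p} := by
  refine Set.Subset.antisymm ?_ (Set.singleton_subset_iff.2 (mem_adjoin ∅ p))
  refine adjoin_subset ?_ (Set.empty_subset _) rfl
  rintro x rfl y rfl h
  exact absurd rfl h

theorem IsPerpSpace.mem_quotientPoints (hG : G.IsPerpSpace) {S X : Set P} (hS : G.IsSingular S) :
    X ∈ G.quotientPoints S ↔ S ⊆ X ∧ G.IsSingular X ∧ G.rk X = G.rk S + 1 := by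
  refine and_congr_right fun _ => ?_
  constructor
  · rintro ⟨d, hd, hX⟩
    have h1 := (hG.hasDim_iff hS).1 hd
    obtain ⟨sX, rX⟩ := hG.mem_grassmannian.1 hX
    exact ⟨sX, by omega⟩
  · rintro ⟨sX, rX⟩
    exact ⟨(G.rk S : ℤ) - 1, (hG.hasDim_iff hS).2 (by omega),
      hG.mem_grassmannian.2 ⟨sX, by omega⟩⟩

theorem IsPerpSpace.mem_quotient_lines (hG : G.IsPerpSpace) {S : Set P} (hS : G.IsSingular S)
    {L : Set (G.quotientPoints S)} : L ∈ (G.quotient S).lines ↔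
      ∃ U, G.IsSingular U ∧ G.rk U = G.rk S + 2 ∧ S ⊆ U ∧ L = {X | X.1 ⊆ U} := by
  constructor
  · rintro ⟨d, hd, U, hU, hSU, rfl⟩
    have h1 := (hG.hasDim_iff hS).1 hd
    obtain ⟨sU, rU⟩ := hG.mem_grassmannian.1 hU
    exact ⟨U, sU, by omega, hSU, rfl⟩
  · rintro ⟨U, sU, rU, hSU, rfl⟩
    exact ⟨(G.rk S : ℤ) - 1, (hG.hasDim_iff hS).2 (by omega), U,
      hG.mem_grassmannian.2 ⟨sU, by omega⟩, hSU, rfl⟩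

/-- The singular subspaces of the quotient by `S` contained in a singular subspace `X` are exhausted
by a subspace of the quotient whose points cover a spanning set of `X`. -/
theorem IsPerpSpace.mem_of_subset_of_spanned (hG : G.IsPerpSpace) {S X : Set P}
    (hS : G.IsSingular S) (hX : G.IsSingular X) (hSX : S ⊆ X) {T : Set (G.quotientPoints S)}
    (hT : (G.quotient S).IsSubspace T)
    (hspan : ∀ W, G.IsSubspace W → (∀ Z ∈ T, Z.1 ⊆ X → Z.1 ⊆ W) → X ⊆ W)
    (Y : G.quotientPoints S) (hY : Y.1 ⊆ X) : Y ∈ T := by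
  have uniq : ∀ (Z : G.quotientPoints S) (q : P), q ∈ Z.1 → q ∉ S → G.adjoin S q = Z.1 := by
    intro Z q hq hqS
    obtain ⟨hSZ, sZ, rZ⟩ := (hG.mem_quotientPoints hS).1 Z.2
    exact hG.adjoin_eq_of_rk hS sZ hSZ rZ.le hq hqS
  have pt : ∀ q ∈ X, q ∉ S → ∃ Z : G.quotientPoints S, q ∈ Z.1 ∧ Z.1 ⊆ X := by
    intro q hq hqS
    have hqr := hG.mem_residue_of_mem hX hSX hq hqS
    exact ⟨⟨G.adjoin S q, (hG.mem_quotientPoints hS).2 ⟨subset_adjoin S q,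
      hG.isSingular_adjoin hS hqr.2, hG.rk_adjoin hS hqr⟩⟩, mem_adjoin S q,
      adjoin_subset hX.1 hSX hq⟩
  -- Apart from points of S, these are the points of X whose quotient point, which is unique,
  -- belongs to T. That W is a subspace lets `hspan` conclude that W is all of X.
  let W : Set P := {q | q ∈ X ∧ ∀ Z : G.quotientPoints S, q ∈ Z.1 → q ∉ S → Z ∈ T}
  have hW : G.IsSubspace W := by
    rintro q₁ ⟨hq₁, h₁⟩ q₂ ⟨hq₂, h₂⟩ hne L hL hL₁ hL₂ q hq
    refine ⟨hX.1 q₁ hq₁ q₂ hq₂ hne L hL hL₁ hL₂ hq, fun Z hqZ hqS => ?_⟩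
    have line : ∀ A, G.IsSubspace A → q₁ ∈ A → q₂ ∈ A → q ∈ A := fun A hA ha hb =>
      hA q₁ ha q₂ hb hne L hL hL₁ hL₂ hq
    have sub : ∀ Z' : G.quotientPoints S, G.IsSubspace Z'.1 ∧ S ⊆ Z'.1 := fun Z' =>
      ⟨((hG.mem_quotientPoints hS).1 Z'.2).2.1.1, Z'.2.1⟩
    have same : ∀ Z' : G.quotientPoints S, q₁ ∈ Z'.1 → q₂ ∈ Z'.1 → Z' = Z := fun Z' ha hb =>
      Subtype.ext ((uniq Z' q (line _ (sub Z').1 ha hb) hqS).symm.trans (uniq Z q hqZ hqS))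
    by_cases s₁ : q₁ ∈ S
    · by_cases s₂ : q₂ ∈ S
      · exact absurd (line S hS.1 s₁ s₂) hqS
      · obtain ⟨Z₂, hZ₂, _⟩ := pt q₂ hq₂ s₂
        exact same Z₂ ((sub Z₂).2 s₁) hZ₂ ▸ h₂ Z₂ hZ₂ s₂
    obtain ⟨Z₁, hZ₁, hZ₁X⟩ := pt q₁ hq₁ s₁
    by_cases hq₂Z : q₂ ∈ Z₁.1
    · exact same Z₁ hZ₁ hq₂Z ▸ h₁ Z₁ hZ₁ s₁
    have s₂ : q₂ ∉ S := fun h => hq₂Z ((sub Z₁).2 h)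
    obtain ⟨Z₂, hZ₂, _⟩ := pt q₂ hq₂ s₂
    obtain ⟨hSZ₁, sZ₁, rZ₁⟩ := (hG.mem_quotientPoints hS).1 Z₁.2
    have hres := hG.mem_residue_of_mem hX hZ₁X hq₂ hq₂Z
    have sU := hG.isSingular_adjoin sZ₁ hres.2
    have hSU : S ⊆ G.adjoin Z₁.1 q₂ := hSZ₁.trans (subset_adjoin _ q₂)
    have hU : {V : G.quotientPoints S | V.1 ⊆ G.adjoin Z₁.1 q₂} ∈ (G.quotient S).lines :=
      (hG.mem_quotient_lines hS).2 ⟨_, sU, by rw [hG.rk_adjoin sZ₁ hres, rZ₁], hSU, rfl⟩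
    refine hT Z₁ (h₁ Z₁ hZ₁ s₁) Z₂ (h₂ Z₂ hZ₂ s₂) (fun h => hq₂Z (h ▸ hZ₂)) _ hU
      (subset_adjoin Z₁.1 q₂) ?_ ?_
    · rw [Set.mem_ofPred_eq, ← uniq Z₂ q₂ hZ₂ s₂]
      exact adjoin_subset sU.1 hSU (mem_adjoin _ q₂)
    · rw [Set.mem_ofPred_eq, ← uniq Z q hqZ hqS]
      exact adjoin_subset sU.1 hSU (line _ sU.1 (subset_adjoin _ q₂ hZ₁) (mem_adjoin _ q₂))
  have hXW : X ⊆ W := by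
    refine hspan W hW fun Z hZ hZX q hq => ⟨hZX hq, fun Z' hq' hqS => ?_⟩
    exact Subtype.ext ((uniq Z q hq hqS).symm.trans (uniq Z' q hq' hqS)) ▸ hZ
  obtain ⟨hSY, sY, rY⟩ := (hG.mem_quotientPoints hS).1 Y.2
  obtain ⟨q, hq, hqS⟩ := hG.exists_mem_notMem hS sY (by omega)
  exact (hXW (hY hq)).2 Y hq hqS

/-- Two distinct points of a quotient line span the subspace U that defines the line, so U lies in X
as soon as they do. -/
theorem IsPerpSpace.isSubspace_quotient (hG : G.IsPerpSpace) {S X : Set P}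
    (hS : G.IsSingular S) (hX : G.IsSingular X) :
    (G.quotient S).IsSubspace {Y | Y.1 ⊆ X} := by
  intro Y hY Z hZ hne L hL hYL hZL V hV
  obtain ⟨U, sU, rU, _, rfl⟩ := (hG.mem_quotient_lines hS).1 hL
  obtain ⟨_, sY, rY⟩ := (hG.mem_quotientPoints hS).1 Y.2
  obtain ⟨_, sZ, rZ⟩ := (hG.mem_quotientPoints hS).1 Z.2
  have hU := hG.eq_span_union sY sZ sU hYL hZL (by omega) (by omega)
    fun h => hne (Subtype.ext h)
  exact (show V.1 ⊆ U from hV).trans (hU ▸ span_subset hX.1 (Set.union_subset hY hZ))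

/-! ### The induced map on points -/

namespace IsLocalEmbedding

variable {n n' J : ℕ} {F : Set P → Set P'}

theorem isSingular_point (hF : G.IsLocalEmbedding G' 1 J F) (hG : G.IsPerpSpace) (p : P) :
    G'.IsSingular (F (G.adjoin ∅ p)) ∧ G'.rk (F (G.adjoin ∅ p)) = J := by
  have s := hG.isSingular_adjoin IsPerpSpace.isSingular_empty (mem_residue_empty (G := G) p).2
  have r := hG.rk_adjoin IsPerpSpace.isSingular_empty (mem_residue_empty (G := G) p)
  rw [hG.rk_empty] at r
  exact ⟨hF.isSingular _ s r, hF.rk_eq _ s r⟩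

theorem neighbors_points (hF : G.IsLocalEmbedding G' 1 J F) (hG : G.IsPerpSpace) {p q : P}
    (hne : p ≠ q) (hpq : G.Collinear p q) :
    G'.Neighbors (F (G.adjoin ∅ p)) (F (G.adjoin ∅ q)) :=
  hF.neighbors_adjoin hG IsPerpSpace.isSingular_empty (by rw [hG.rk_empty]) (mem_residue_empty p)
    (mem_residue_empty q) hpq (by rw [adjoin_empty]; exact hne.symm)

theorem not_neighbors_points (hF : G.IsLocalEmbedding G' 1 J F) (hG : G.IsPerpSpace) {p q : P}
    (hpq : ¬ G.Collinear p q) : F (G.adjoin ∅ p) ≠ F (G.adjoin ∅ q) ∧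
      ¬ G'.Neighbors (F (G.adjoin ∅ p)) (F (G.adjoin ∅ q)) :=
  hF.not_neighbors_adjoin hG IsPerpSpace.isSingular_empty (by rw [hG.rk_empty])
    (mem_residue_empty p) (mem_residue_empty q) hpq

/-- The images of points share S, which is a hyperplane of each, so distinct perpendicular images
are neighbors and must come from collinear points. -/
theorem perp_points_iff (hF : G.IsLocalEmbedding G' 1 J F) (hG : G.IsPerpSpace)
    (hG' : G'.IsPerpSpace) {S : Set P'} (hS : G'.IsSingular S) (rS : G'.rk S + 1 = J)
    (hSF : ∀ p, S ⊆ F (G.adjoin ∅ p)) {p q : P} :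
    G'.Perp (F (G.adjoin ∅ p)) (F (G.adjoin ∅ q)) ↔ G.Collinear p q := by
  obtain ⟨sp, rp⟩ := hF.isSingular_point hG p
  obtain ⟨sq, rq⟩ := hF.isSingular_point hG q
  constructor
  · intro h
    by_contra hpq
    have hn := hF.not_neighbors_points hG hpq
    have := hG'.rk_mono hS (sp.inter sq.1) (Set.subset_inter (hSF p) (hSF q))
    exact hn.2 ⟨hn.1, h, by omega⟩
  · intro h
    by_cases hpq : p = q
    · exact hpq ▸ hG'.perp_self sp
    · exact (hF.neighbors_points hG hpq h).2.1

/-- Singular subspaces of `G` span singular subspaces of at least the same rank in the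
quotient by `S`. -/
theorem exists_singular_of_hasChainRank (hF : G.IsLocalEmbedding G' 1 J F) (hG : G.IsPerpSpace)
    (hG' : G'.IsPerpSpace) {S : Set P'} (hS : G'.IsSingular S) (rS : G'.rk S + 1 = J)
    (hSF : ∀ p, S ⊆ F (G.adjoin ∅ p)) {N : Set P} {m : ℕ} (hN : G.HasChainRank N m) :
    ∃ V, G'.IsSingular V ∧ G'.rk S + m ≤ G'.rk V ∧
      ∀ q, (∀ x ∈ N, G.Collinear q x) → G'.Perp (F (G.adjoin ∅ q)) V := by
  induction hN with
  | empty => exact ⟨S, hS, le_rfl, fun q _ => (hG'.perp_self (hF.isSingular_point hG q).1).mono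
      subset_rfl (hSF q)⟩
  | @adjoin N m p hN hp ih =>
    obtain ⟨V, sV, rV, hV⟩ := ih
    -- The image of q is perpendicular to V but not to the image of p, so the latter is not inside V
    -- and the rank grows. This is what the perpendicularity clause of the induction is for.
    obtain ⟨q, hqN, hqp, _⟩ := hG.separation (hG.isSingular_of_hasChainRank hN) hp
    have hpV : ¬ F (G.adjoin ∅ p) ⊆ V := fun h =>
      hqp ((hF.perp_points_iff hG hG' hS rS hSF).1 ((hV q hqN).mono subset_rfl h))
    obtain ⟨y, hy, hyV⟩ := Set.not_subset.1 hpV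
    have hyr : y ∈ G'.residue V := ⟨hyV, fun v hv => hV p hp.2 y hy v hv⟩
    refine ⟨G'.adjoin V y, hG'.isSingular_adjoin sV hyr.2, ?_, fun q hq x hx => ?_⟩
    · rw [hG'.rk_adjoin sV hyr]
      omega
    · exact hG'.perp_adjoin (hV q (fun z hz => hq z (subset_adjoin N p hz)) x hx)
        ((hF.perp_points_iff hG hG' hS rS hSF).2 (hq p (mem_adjoin N p)) x hx y hy)

end IsLocalEmbedding

/-- Isometric embeddings of Grassmann graphs are induced by collinearity preserving
injections. -/
theorem IsPerpSpace.isometric_embedding_induced (hG : G.IsPerpSpace) (hG' : G'.IsPerpSpace)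
    {n n' k k' : ℕ} (hn : G.HasRank n) (hn' : G'.HasRank n') (hkn : k + 4 ≤ n)
    (f : G.grassmannGraph n k ↪g G'.grassmannGraph n' k')
    (hf : ∀ X Y, (G'.grassmannGraph n' k').edist (f X) (f Y) =
      (G.grassmannGraph n k).edist X Y) :
    k ≤ k' ∧ (n : ℤ) - k ≤ (n' : ℤ) - k' ∧
    ∃ S ∈ G'.grassmannian ((k' : ℤ) - k - 1),
      Set.range f ⊆ G'.bigStar S k' ∧
      ∃ α : P → G'.quotientPoints S,
        G.IsCollinearityPreservingInjection (G'.quotient S) α ∧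
        G.IsInducedBy G' f S α := by
  obtain ⟨J, F, hD⟩ := exists_isDescent hG hG' hn hn' hkn f hf
  have hF := hD.isLocalEmbedding
  -- The star of the empty subspace consists of all points. Its image S has rank J − 1 = k' − k, by
  -- `rank_add` with i = 1.
  obtain ⟨hS, rS⟩ := hF.starMap_spec hG hG' hn isSingular_empty (by rw [hG.rk_empty]) (by omega)
  set S := G.starMap 1 F ∅
  have s1 : ∀ p : P, G.IsSingular (G.adjoin ∅ p) := fun p =>
    hG.isSingular_adjoin isSingular_empty (mem_residue_empty p).2
  have r1 : ∀ p : P, G.rk (G.adjoin ∅ p) = 1 := fun p => by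
    rw [hG.rk_adjoin isSingular_empty (mem_residue_empty p), hG.rk_empty]
  have hSF : ∀ p, S ⊆ F (G.adjoin ∅ p) := fun p =>
    starMap_subset (s1 p) (r1 p) (Set.empty_subset _)
  have hadd := hD.rank_add
  have hFX : ∀ (X : G.grassmannian k), ∀ p ∈ X.1, F (G.adjoin ∅ p) ⊆ (f X).1 := fun X p hp =>
    hD.subset _ X (s1 p) (r1 p) (adjoin_subset X.2.1.1 (Set.empty_subset _) hp)
  have hSX : ∀ X : G.grassmannian k, S ⊆ (f X).1 := by
    intro X
    obtain ⟨p, hp, _⟩ := hG.exists_mem_notMem isSingular_empty X.2.1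
      (by rw [hG.rk_empty, hG.rk_vertex X]; omega)
    exact (hSF p).trans (hFX X p hp)
  let α : P → G'.quotientPoints S := fun p => ⟨F (G.adjoin ∅ p), (hG'.mem_quotientPoints hS).2
    ⟨hSF p, (hF.isSingular_point hG p).1, by rw [(hF.isSingular_point hG p).2, rS]⟩⟩
  have hjoin : ∀ p q, p ≠ q → G.Collinear p q → (G'.quotient S).Collinear (α p) (α q) := by
    intro p q hne hpq
    obtain ⟨sp, rp⟩ := hF.isSingular_point hG p
    obtain ⟨sq, rq⟩ := hF.isSingular_point hG q
    obtain ⟨U, sU, rU, hpU, hqU, _⟩ := hG'.exists_join sp sq (by omega)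
      (hF.neighbors_points hG hne hpq)
    exact ⟨_, (hG'.mem_quotient_lines hS).2 ⟨U, sU, by omega, (hSF p).trans hpU, rfl⟩, hpU, hqU⟩
  refine ⟨by omega, ?_, S, hG'.mem_grassmannian.2 ⟨hS, by omega⟩, ?_, α, ⟨?_, ?_⟩, ?_⟩
  -- A singular subspace of rank n gives one of rank at least k' − k + n in the target, where ranks
  -- are at most n'.
  · obtain ⟨M, sM, rM⟩ := hG.exists_singular_rk hn le_rfl
    obtain ⟨V, sV, rV, _⟩ := hF.exists_singular_of_hasChainRank hG hG' hS rS hSF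
      (hG.hasChainRank_rk sM)
    have := hG'.rk_le hn' sV
    omega
  · rintro _ ⟨X, rfl⟩
    exact hSX X
  · intro p q hpq
    by_contra hne
    have hpq' : F (G.adjoin ∅ p) = F (G.adjoin ∅ q) := congrArg Subtype.val hpq
    by_cases hc : G.Collinear p q
    · exact (hF.neighbors_points hG hne hc).1 hpq'
    · exact (hF.not_neighbors_points hG hc).1 hpq'
  · intro p q
    constructor
    · rintro ⟨L, hL, hpL, hqL⟩
      obtain ⟨U, sU, _, _, rfl⟩ := (hG'.mem_quotient_lines hS).1 hL
      exact (hF.perp_points_iff hG hG' hS rS hSF).1 ((hG'.perp_self sU).mono hpL hqL)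
    · intro hpq
      by_cases hne : p = q
      · subst hne
        -- Collinearity of a quotient point with itself needs a line through it; the join with the
        -- image of a neighbor b of p provides one.
        obtain ⟨b, hb⟩ := hG.exists_mem_residue hn (s1 p) (by rw [r1 p]; omega)
        have hpb : p ≠ b := by
          rintro rfl
          exact hb.1 (mem_adjoin ∅ p)
        obtain ⟨L, hL, hp, _⟩ := hjoin p b hpb (hb.2 p (mem_adjoin ∅ p)).symm
        exact ⟨L, hL, hp, hp⟩
      · exact hjoin p q hne hpq
  · intro X
    apply Set.Subset.antisymm
    · apply span_subset (hG'.isSubspace_quotient hS (f X).2.1)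
      rintro _ ⟨p, hp, rfl⟩
      exact hFX X p hp
    · intro Y hY T hT
      refine hG'.mem_of_subset_of_spanned hS (f X).2.1 (hSX X) hT.1 (fun W hW hTW => ?_) Y hY
      refine hD.spanned X W hW fun R sR rR hRX => ?_
      obtain ⟨p, _, rfl⟩ := hG.exists_adjoin_eq isSingular_empty sR (Set.empty_subset R)
        (by rw [rR, hG.rk_empty])
      have hpX := hRX (mem_adjoin ∅ p)
      exact hTW (α p) (hT.2 ⟨p, hpX, rfl⟩) (hFX X p hpX)

end PointLineGeometry

theorem theorem1 {P : Type*} {P' : Type*} (G : PointLineGeometry P) (G' : PointLineGeometry P')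
    (n n' k k' : ℕ)
    (hG : (G.IsPolarSpace ∧ G.HasRank n) ∨ G.IsThinPolarSpace n)
    (hG' : G'.IsPolarSpace) (hn' : G'.HasRank n')
    (hn : 5 ≤ n) (hk : 1 ≤ k) (hkn : k + 4 ≤ n)
    (f : G.grassmannGraph n k ↪g G'.grassmannGraph n' k')
    (hf : ∀ X Y, (G'.grassmannGraph n' k').edist (f X) (f Y) =
      (G.grassmannGraph n k).edist X Y) :
    k ≤ k' ∧ (n : ℤ) - k ≤ (n' : ℤ) - k' ∧
    ∃ S ∈ G'.grassmannian ((k' : ℤ) - k - 1),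
      Set.range f ⊆ G'.bigStar S k' ∧
      ∃ α : P → G'.quotientPoints S,
        G.IsCollinearityPreservingInjection (G'.quotient S) α ∧
        G.IsInducedBy G' f S α := by
  have hperp : G.IsPerpSpace ∧ G.HasRank n := hG.elim (fun h => ⟨h.1.isPerpSpace, h.2⟩)
    fun h => ⟨h.isPerpSpace (by omega), h.hasRank (by omega)⟩
  exact hperp.1.isometric_embedding_induced hG'.isPerpSpace hperp.2 hn' hkn f hf
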